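/- Let $0<\lambda<\mu$. On a probability space, let $\mathcal A=(A_n)_{n\in\mathbb Z}$ be a homogeneous Poisson process of intensity $\lambda$ on $\mathbb R$, its points being numbered in increasing order with $A_0\le 0<A_1$ almost surely, and let $s=(s_n)_{n\in\mathbb Z}$ be a sequence of i.i.d. exponential random variables of parameter $\mu$ (mean $1/\mu$), independent of $\mathcal A$. Consider the single-server first-in-first-out queue in equilibrium in which customer $n$ arrives at time $A_n$ and requires the service time $s_n$. Thus customer $n$ departs at time $$D_n=\sup_{k\le n}\Bigl[A_k+\sum_{i=k}^{n}s_i\Bigr],\qquad n\in\mathbb Z,$$ and the time it spends at the very back of the queue is $$r_n=\min(D_n,A_{n+1})-A_n,\qquad n\in\mathbb Z.$$ Then almost surely all the suprema $D_n$ are finite, $D_n<D_{n+1}$ and $r_n>0$ for all $n$, and $D_n\to\pm\infty$ as $n\to\pm\infty$, so that $(\mathcal D,r)=(D_n,r_n)_{n\in\mathbb Z}$ is a marked point process. Moreover, the marked point process $(\mathcal D,r)$ has the same law as the marked point process $(\mathcal A,s)$: the random counting measures $\sum_{n\in\mathbb Z}\delta_{(D_n,r_n)}$ and $\sum_{n\in\mathbb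 Z}\delta_{(A_n,s_n)}$ on $\mathbb R\times\mathbb R$ have the same distribution. -/

import Mathlib

open MeasureTheory ProbabilityTheory Filter

noncomputable section

/-- A simple, locally finite point process on the real line with infinitely many positive and
infinitely many negative points, given by the increasing sequence of its points. -/
structure IsPointProcess {Ω : Type*} [MeasurableSpace Ω] (P : Measure Ω) (A : ℤ → Ω → ℝ) :
    Prop where
  measurable : ∀ n, Measurable (A n)
  strictMono : ∀ᵐ ω ∂P, StrictMono fun n => A n ω
  tendsto_atTop : ∀ᵐ ω ∂P, Tendsto (fun n => A n ω) atTop atTop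
  tendsto_atBot : ∀ᵐ ω ∂P, Tendsto (fun n => A n ω) atBot atBot

/-- The number of points in `B`; it is used for bounded sets `B`, where a point process has
almost surely finitely many points. -/
def pointCount {Ω : Type*} (A : ℤ → Ω → ℝ) (B : Set ℝ) (ω : Ω) : ℕ :=
  {n : ℤ | A n ω ∈ B}.ncard

/-- A homogeneous Poisson process of intensity `lam` on the real line. -/
structure IsPoissonProcess {Ω : Type*} [MeasurableSpace Ω] (P : Measure Ω) (lam : ℝ)
    (A : ℤ → Ω → ℝ) : Prop extends IsPointProcess P A where
  hasLaw_count : ∀ B : Set ℝ, MeasurableSet B → Bornology.IsBounded B →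
    HasLaw (pointCount A B) (poissonMeasure (Real.toNNReal (lam * volume.real B))) P
  indep_count : ∀ (k : ℕ) (B : Fin k → Set ℝ), (∀ i, MeasurableSet (B i)) →
    (∀ i, Bornology.IsBounded (B i)) → Pairwise (fun i j => Disjoint (B i) (B j)) →
    iIndepFun (fun i => pointCount A (B i)) P

/-- `A k + ∑_{i=k}^n s i`: the departure instant of customer `n` if the service of customer `k`
begins at its arrival and the server is never idle from then until customer `n` has left. -/
def departureCandidate {Ω : Type*} (A s : ℤ → Ω → ℝ) (n k : ℤ) (ω : Ω) : ℝ :=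
  A k ω + ∑ i ∈ Finset.Icc k n, s i ω

/-- The departure instants `D n = sup_{k ≤ n} (A k + ∑_{i=k}^n s i)`. The supremum is taken in
the real numbers, hence meaningful where the set of candidates is bounded above. -/
def departure {Ω : Type*} (A s : ℤ → Ω → ℝ) (n : ℤ) (ω : Ω) : ℝ :=
  ⨆ k : Set.Iic n, departureCandidate A s n k ω

/-- The time spent by customer `n` at the very back of the queue. -/
def backTime {Ω : Type*} (A s : ℤ → Ω → ℝ) (n : ℤ) (ω : Ω) : ℝ :=
  min (departure A s n ω) (A (n + 1) ω) - A n ω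

/-- The marked point process with points `A n` and marks `c n` as a random counting measure on
the set of pairs (point, mark). It does not depend on the numbering of the points. -/
def markedPointMeasure {Ω : Type*} (A c : ℤ → Ω → ℝ) (ω : Ω) : Measure (ℝ × ℝ) :=
  Measure.sum fun n : ℤ => Measure.dirac (A n ω, c n ω)

end

/-!
The proof works with typical customers instead of a typical instant.

Let the customers have independent exponential interarrival times and service times, with customer
`0` arriving at time `0`, and let customer `0` find the queue in equilibrium. The time `T n` which
customer `n` spends in the system satisfies a recursion `T (n + 1) = nextSojourn (T n) (e n)`, where
`e n` consists of the interarrival time from customer `n` to customer `n + 1` and of the service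
time of customer `n + 1`. The pair (departure gap, back time) of step `n` is a function
`stepOutput (T n) (e n)` of the same data. An elementary computation with exponential variables
(`lintegral_queueStep`) shows that, if `T n` is exponential with parameter `mu - lam` and
independent of `e n`, then `T (n + 1)` and the pair `stepOutput (T n) (e n)` are independent,
`T (n + 1)` is again exponential with parameter `mu - lam`, and the pair has the law of `e n`: in
terms of `x = T n - (e n).1`, the back time `r` and the service time `s`, the step exchanges `r` and
`s`, and the joint density is symmetric in them (`exponentialPDF_mul_symm`). Hence in equilibrium
the successive output pairs are independent with the law of the input pairs. The queue forgets its
initial state because two solutions of the recursion driven by the same input meet after a finite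
time, and so the same holds for the queue fed since time `-∞`: `map_palmOutput`, Burke's theorem in
the form which holds for the Palm measures.

Passing from Palm measures to the stationary queue requires two facts. One is that a Poisson
process, numbered around the origin, arises from i.i.d. exponential gaps by choosing a gap with a
bias for its length and placing the origin uniformly in it
(`IsPoissonProcess.map_eq_sizeBiasedPoints`); both laws are computed on boxes
`b i < x i ≤ c i`, `-m ≤ i ≤ m + 1`, with disjoint intervals, and such boxes determine the law of
an increasing sequence. Thus expectations for the stationary queue are `lam` times the mean of an
integral over the arrival cycle `[A 0, A 1)` of the Palm queue
(`IsPoissonProcess.lintegral_palm`). The other fact is that this cycle may be replaced by the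
departure cycle `[D 0, D 1)` (`lintegral_arrival_cycle_eq_departure_cycle`): the integrals over the
two cycles differ by the difference of the integrals over `[A 0, D 0)` and `[A 1, D 1)`, whose
means agree by stationarity and are finite since `D 0 - A 0` is integrable. Over the departure
cycle, the departures marked with the back times look, by Burke's theorem, exactly as the arrivals
marked with the service times look over an arrival cycle.
-/

open scoped ENNReal Topology

/-! ### The queue driven by fixed sequences -/

/-- The departure instant of customer `n` in the queue with arrival instants `x` and service
times `s`: the value of `departure` at a single realisation. -/
noncomputable def departureTime (x s : ℤ → ℝ) (n : ℤ) : ℝ :=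
  ⨆ k : Set.Iic n, (x k + ∑ i ∈ Finset.Icc (k : ℤ) n, s i)

/-- Arrival instants `x` and service times `s` for which the queue is stable: positive service
times and a work load which, looking into the past, is outweighed by the elapsed time. -/
structure StableInput (x s : ℤ → ℝ) : Prop where
  strictMono : StrictMono x
  tendsto_atTop : Tendsto x atTop atTop
  tendsto_atBot : Tendsto x atBot atBot
  service_pos : ∀ n, 0 < s n
  drift : Tendsto (fun k => x k + ∑ i ∈ Finset.Icc k 0, s i) atBot atBot

theorem Int.sum_Icc_add_one (s : ℤ → ℝ) {k n : ℤ} (h : k ≤ n + 1) :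
    ∑ i ∈ Finset.Icc k (n + 1), s i = ∑ i ∈ Finset.Icc k n, s i + s (n + 1) := by
  have : Finset.Icc k (n + 1) = insert (n + 1) (Finset.Icc k n) := by
    ext i; simp only [Finset.mem_Icc, Finset.mem_insert]; omega
  rw [this, Finset.sum_insert (by simp), add_comm]

namespace StableInput

variable {x s : ℤ → ℝ}

theorem drift_at (h : StableInput x s) (n : ℤ) :
    Tendsto (fun k => x k + ∑ i ∈ Finset.Icc k n, s i) atBot atBot := by
  induction n using Int.induction_on with
  | zero => exact h.drift
  | succ n ih =>
    refine (tendsto_atBot_add_const_right _ (s (n + 1)) ih).congr' ?_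
    filter_upwards [eventually_le_atBot ((n : ℤ) + 1)] with k hk
    rw [Int.sum_Icc_add_one s hk]; ring
  | pred n ih =>
    refine (tendsto_atBot_add_const_right _ (-s (-n)) ih).congr' ?_
    filter_upwards [eventually_le_atBot (-(n : ℤ))] with k hk
    have := Int.sum_Icc_add_one s (k := k) (n := -(n : ℤ) - 1) (by omega)
    rw [sub_add_cancel] at this
    rw [this]; ring

theorem bddAbove (h : StableInput x s) (n : ℤ) :
    BddAbove (Set.range fun k : Set.Iic n => x k + ∑ i ∈ Finset.Icc (k : ℤ) n, s i) := by
  obtain ⟨K, hK⟩ := eventually_atBot.1 ((h.drift_at n).eventually_le_atBot 0)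
  obtain ⟨B, hB⟩ := ((Set.finite_Icc K n).image
    fun k => x k + ∑ i ∈ Finset.Icc k n, s i).bddAbove
  refine ⟨max B 0, ?_⟩
  rintro _ ⟨⟨k, hk⟩, rfl⟩
  rcases le_total k K with hkK | hkK
  · exact (hK k hkK).trans (le_max_right _ _)
  · exact (hB ⟨k, ⟨hkK, hk⟩, rfl⟩).trans (le_max_left _ _)

theorem le_departureTime (h : StableInput x s) {k n : ℤ} (hk : k ≤ n) :
    x k + ∑ i ∈ Finset.Icc k n, s i ≤ departureTime x s n :=
  le_ciSup (h.bddAbove n) (⟨k, hk⟩ : Set.Iic n)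

/-- Lindley's recursion. -/
theorem departureTime_add_one (h : StableInput x s) (n : ℤ) :
    departureTime x s (n + 1) = max (departureTime x s n) (x (n + 1)) + s (n + 1) := by
  apply le_antisymm
  · refine ciSup_le fun ⟨k, hk⟩ => ?_
    rw [Set.mem_Iic] at hk
    rw [Int.sum_Icc_add_one s hk, ← add_assoc]
    gcongr
    rcases hk.lt_or_eq with hk | rfl
    · exact (h.le_departureTime (show k ≤ n by omega)).trans (le_max_left _ _)
    · simp
  · rw [← le_sub_iff_add_le, max_le_iff]
    constructor
    · refine ciSup_le fun ⟨k, hk⟩ => ?_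
      replace hk : k ≤ n := hk
      have := h.le_departureTime (show k ≤ n + 1 by omega)
      rw [Int.sum_Icc_add_one s (show k ≤ n + 1 by omega)] at this
      dsimp only
      linarith
    · have := h.le_departureTime (le_refl (n + 1))
      simp only [Finset.Icc_self, Finset.sum_singleton] at this
      linarith

theorem arrival_lt_departureTime (h : StableInput x s) (n : ℤ) : x n < departureTime x s n := by
  have := h.le_departureTime (le_refl n)
  simp only [Finset.Icc_self, Finset.sum_singleton] at this
  linarith [h.service_pos n]

theorem strictMono_departureTime (h : StableInput x s) : StrictMono (departureTime x s) := by
  refine strictMono_int_of_lt_succ fun n => ?_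
  rw [h.departureTime_add_one]
  linarith [le_max_left (departureTime x s n) (x (n + 1)), h.service_pos (n + 1)]

theorem tendsto_departureTime_atTop (h : StableInput x s) :
    Tendsto (departureTime x s) atTop atTop :=
  tendsto_atTop_mono (fun n => (h.arrival_lt_departureTime n).le) h.tendsto_atTop

theorem tendsto_departureTime_atBot (h : StableInput x s) :
    Tendsto (departureTime x s) atBot atBot := by
  refine Filter.tendsto_atBot.2 fun M => ?_
  obtain ⟨K, hK⟩ := eventually_atBot.1 (h.drift.eventually_le_atBot M)
  filter_upwards [eventually_le_atBot K, eventually_le_atBot 0] with n hn hn0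
  refine ciSup_le fun ⟨k, hk⟩ => (le_trans ?_ (hK k (le_trans hk hn)))
  dsimp only
  gcongr x k + ?_
  exact Finset.sum_le_sum_of_subset_of_nonneg (Finset.Icc_subset_Icc_right hn0)
    fun i _ _ => (h.service_pos i).le

theorem backTime_pos (h : StableInput x s) (n : ℤ) :
    0 < min (departureTime x s n) (x (n + 1)) - x n :=
  sub_pos.2 (lt_min (h.arrival_lt_departureTime n) (h.strictMono (lt_add_one n)))

theorem departureTime_sub (h : StableInput x s) (u : ℝ) (n : ℤ) :
    departureTime (fun k => x k - u) s n = departureTime x s n - u := by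
  unfold departureTime
  rw [sub_eq_add_neg, ciSup_add (h.bddAbove n)]
  congr 1; ext k; ring

theorem sub_const (h : StableInput x s) (u : ℝ) : StableInput (fun k => x k - u) s where
  strictMono := fun i j hij => sub_lt_sub_right (h.strictMono hij) u
  tendsto_atTop := by
    simpa [sub_eq_add_neg] using tendsto_atTop_add_const_right _ (-u) h.tendsto_atTop
  tendsto_atBot := by
    simpa [sub_eq_add_neg] using tendsto_atBot_add_const_right _ (-u) h.tendsto_atBot
  service_pos := h.service_pos
  drift := by
    refine (tendsto_atBot_add_const_right _ (-u) h.drift).congr fun k => ?_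
    ring

end StableInput

theorem departureTime_shift (x s : ℤ → ℝ) (j n : ℤ) :
    departureTime (fun k => x (k + j)) (fun k => s (k + j)) n = departureTime x s (n + j) := by
  let e : Set.Iic n ≃ Set.Iic (n + j) :=
    (Equiv.addRight j).subtypeEquiv fun k => by simp
  refine Equiv.iSup_congr e fun ⟨k, hk⟩ => ?_
  have := Finset.sum_map (Finset.Icc k n) (addRightEmbedding j) s
  rw [Finset.map_add_right_Icc] at this
  simpa [e] using this

theorem measurable_departureTime {α : Type*} [MeasurableSpace α] {x s : ℤ → α → ℝ}
    (hx : ∀ n, Measurable (x n)) (hs : ∀ n, Measurable (s n)) (n : ℤ) :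
    Measurable fun a => departureTime (fun k => x k a) (fun k => s k a) n :=
  Measurable.iSup fun k => (hx k).add (Finset.measurable_sum _ fun i _ => hs i)

/-! ### Exponential variables and one step of the queue -/

@[fun_prop]
theorem measurable_exponentialPDF (r : ℝ) : Measurable (exponentialPDF r) :=
  (measurable_exponentialPDFReal r).ennreal_ofReal

theorem lintegral_expMeasure (r : ℝ) {f : ℝ → ℝ≥0∞} (hf : Measurable f) :
    ∫⁻ x, f x ∂(expMeasure r) = ∫⁻ x, exponentialPDF r x * f x :=
  lintegral_withDensity_eq_lintegral_mul _ (measurable_exponentialPDF r) hf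

theorem lintegral_ofReal_expMeasure {r : ℝ} (hr : 0 < r) :
    ∫⁻ x, ENNReal.ofReal x ∂(expMeasure r) = ENNReal.ofReal r⁻¹ := by
  rw [lintegral_expMeasure r ENNReal.measurable_ofReal]
  -- `x` times the density is `1 / r` times the Gamma density of shape `2`
  have key : ∀ x, exponentialPDF r x * ENNReal.ofReal x
      = ENNReal.ofReal r⁻¹ * gammaPDF 2 r x := by
    intro x
    rcases lt_or_ge x 0 with hx | hx
    · rw [exponentialPDF_of_neg hx, gammaPDF_of_neg hx]; simp
    · rw [exponentialPDF_of_nonneg hx, gammaPDF_of_nonneg hx, ← ENNReal.ofReal_mul (by positivity),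
        ← ENNReal.ofReal_mul (by positivity)]
      have : Real.Gamma 2 = 1 := Real.Gamma_two
      have h1 : (2 : ℝ) - 1 = 1 := by norm_num
      rw [this, h1, Real.rpow_one]
      congr 1
      have : r ^ (2 : ℝ) = r ^ 2 := by norm_cast
      rw [this]; field_simp
  simp_rw [key]
  rw [lintegral_const_mul' _ _ ENNReal.ofReal_ne_top, lintegral_gammaPDF_eq_one two_pos hr, mul_one]

theorem ae_pos_expMeasure (r : ℝ) : ∀ᵐ x ∂(expMeasure r), 0 < x := by
  rw [ae_iff, expMeasure, gammaMeasure]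
  simp only [not_lt]
  change (volume.withDensity _) (Set.Iic 0) = 0
  rw [withDensity_apply _ measurableSet_Iic, setLIntegral_congr Iio_ae_eq_Iic.symm]
  exact lintegral_exponentialPDF_of_nonpos le_rfl

theorem integrable_id_expMeasure {r : ℝ} (hr : 0 < r) : Integrable id (expMeasure r) := by
  refine ⟨measurable_id.aestronglyMeasurable, ?_⟩
  change HasFiniteIntegral (fun x => x) _
  rw [hasFiniteIntegral_iff_ofReal ((ae_pos_expMeasure r).mono fun x hx => hx.le)]
  rw [lintegral_ofReal_expMeasure hr]
  exact ENNReal.ofReal_lt_top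

theorem integral_id_expMeasure {r : ℝ} (hr : 0 < r) : ∫ x, x ∂(expMeasure r) = r⁻¹ := by
  rw [integral_eq_lintegral_of_nonneg_ae ((ae_pos_expMeasure r).mono fun x hx => hx.le)
    measurable_id.aestronglyMeasurable, lintegral_ofReal_expMeasure hr,
    ENNReal.toReal_ofReal (by positivity)]

/-- Plane Lebesgue measure in the coordinates `x = S - a` and `r = min S a`. -/
theorem lintegral_lintegral_sub_min {f : ℝ → ℝ → ℝ≥0∞} (hf : Measurable (Function.uncurry f)) :
    ∫⁻ S, ∫⁻ a, f S a = ∫⁻ x, ∫⁻ r, f (r + max x 0) (r + max (-x) 0) := by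
  calc ∫⁻ S, ∫⁻ a, f S a = ∫⁻ a, ∫⁻ S, f S a := lintegral_lintegral_swap hf.aemeasurable
    _ = ∫⁻ a, ∫⁻ x, f (x + a) a :=
        lintegral_congr fun a => (lintegral_add_right_eq_self (fun S => f S a) a).symm
    _ = ∫⁻ x, ∫⁻ a, f (x + a) a := by
        refine lintegral_lintegral_swap (Measurable.aemeasurable ?_)
        exact hf.comp ((measurable_snd.add measurable_fst).prodMk measurable_fst)
    _ = _ := by
        refine lintegral_congr fun x => ?_
        rw [← lintegral_add_right_eq_self (fun a => f (x + a) a) (max (-x) 0)]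
        refine lintegral_congr fun r => ?_
        congr 1
        rcases le_total 0 x with h | h
        · rw [max_eq_left h, max_eq_right (by linarith)]; ring
        · rw [max_eq_right h, max_eq_left (by linarith)]; ring

/-- The sojourn time of the next customer, if the present customer has sojourn time `t`, the next
customer arrives `e.1` later and requires the service time `e.2`. -/
noncomputable def nextSojourn (t : ℝ) (e : ℝ × ℝ) : ℝ := max (t - e.1) 0 + e.2

/-- The time from the present to the next departure, and the time the present customer spends at
the back of the queue; the data are as in `nextSojourn`. -/
noncomputable def stepOutput (t : ℝ) (e : ℝ × ℝ) : ℝ × ℝ := (max (e.1 - t) 0 + e.2, min t e.1)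

@[fun_prop]
theorem Measurable.nextSojourn {α : Type*} [MeasurableSpace α] {f : α → ℝ} {g : α → ℝ × ℝ}
    (hf : Measurable f) (hg : Measurable g) : Measurable fun x => nextSojourn (f x) (g x) := by
  unfold _root_.nextSojourn; fun_prop

@[fun_prop]
theorem Measurable.stepOutput {α : Type*} [MeasurableSpace α] {f : α → ℝ} {g : α → ℝ × ℝ}
    (hf : Measurable f) (hg : Measurable g) : Measurable fun x => stepOutput (f x) (g x) := by
  unfold _root_.stepOutput; fun_prop

/-- The law of an interarrival time and an independent service time. -/
noncomputable def gapService (lam mu : ℝ) : Measure (ℝ × ℝ) :=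
  (expMeasure lam).prod (expMeasure mu)

theorem isProbabilityMeasure_gapService {lam mu : ℝ} (hlam : 0 < lam) (hmu : 0 < mu) :
    IsProbabilityMeasure (gapService lam mu) := by
  have := isProbabilityMeasure_expMeasure hlam
  have := isProbabilityMeasure_expMeasure hmu
  unfold gapService; infer_instance

/-- In the coordinates of `lintegral_lintegral_sub_min`, the joint density of sojourn time, gap
and service time is symmetric in the back time `r` and the service time `s`. -/
theorem exponentialPDF_mul_symm {lam mu : ℝ} (hlam : 0 < lam) (hmu : lam < mu) (x r s : ℝ) :
    exponentialPDF (mu - lam) (r + max x 0) * exponentialPDF lam (r + max (-x) 0)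
        * exponentialPDF mu s
      = exponentialPDF (mu - lam) (s + max x 0) * exponentialPDF lam (s + max (-x) 0)
        * exponentialPDF mu r := by
  have zero : ∀ r s, r < 0 → exponentialPDF (mu - lam) (r + max x 0)
      * exponentialPDF lam (r + max (-x) 0) * exponentialPDF mu s = 0 := by
    intro r s hr
    rcases le_total 0 x with h | h
    · rw [max_eq_right (show -x ≤ 0 by linarith), exponentialPDF_of_neg (x := r + 0) (by linarith)]
      simp
    · rw [max_eq_right h, exponentialPDF_of_neg (x := r + 0) (by linarith)]; simp
  rcases lt_or_ge r 0 with hr | hr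
  · rw [zero r s hr, exponentialPDF_of_neg hr, mul_zero]
  rcases lt_or_ge s 0 with hs | hs
  · rw [zero s r hs, exponentialPDF_of_neg hs, mul_zero]
  have hx := le_max_right x 0
  have hx' := le_max_right (-x) 0
  have hd : 0 < mu - lam := by linarith
  have hmu0 : 0 < mu := by linarith
  rw [exponentialPDF_of_nonneg (by linarith), exponentialPDF_of_nonneg (by linarith),
    exponentialPDF_of_nonneg hs, exponentialPDF_of_nonneg (by linarith),
    exponentialPDF_of_nonneg (by linarith), exponentialPDF_of_nonneg hr]
  rw [← ENNReal.ofReal_mul (by positivity), ← ENNReal.ofReal_mul (by positivity),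
    ← ENNReal.ofReal_mul (by positivity), ← ENNReal.ofReal_mul (by positivity)]
  congr 1
  have : ∀ u v w A B C : ℝ, u * Real.exp A * (v * Real.exp B) * (w * Real.exp C)
      = u * v * w * Real.exp (A + B + C) := by
    intros; rw [Real.exp_add, Real.exp_add]; ring
  rw [this, this]
  congr 2
  ring

/-- One step of the queue in equilibrium: departure gap, back time and next sojourn time are
independent, with the laws of an arrival gap, a service time and a sojourn time. -/
theorem lintegral_queueStep {lam mu : ℝ} (hlam : 0 < lam) (hmu : lam < mu)
    {G : ℝ × ℝ → ℝ → ℝ≥0∞} (hG : Measurable (Function.uncurry G)) :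
    ∫⁻ t, ∫⁻ e, G (stepOutput t e) (nextSojourn t e) ∂(gapService lam mu) ∂(expMeasure (mu - lam))
      = ∫⁻ o, ∫⁻ t, G o t ∂(expMeasure (mu - lam)) ∂(gapService lam mu) := by
  have := isProbabilityMeasure_expMeasure hlam
  have := isProbabilityMeasure_expMeasure (hlam.trans hmu)
  have := isProbabilityMeasure_expMeasure (sub_pos.2 hmu)
  -- a service time `s`, a sojourn time `S` and a gap `a`, integrated against their joint density
  have expand : ∀ H : ℝ → ℝ → ℝ → ℝ≥0∞, Measurable (fun p : ℝ × ℝ × ℝ => H p.1 p.2.1 p.2.2) →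
      ∫⁻ s, ∫⁻ S, ∫⁻ a, H s S a ∂(expMeasure lam) ∂(expMeasure (mu - lam)) ∂(expMeasure mu)
        = ∫⁻ s, ∫⁻ x, ∫⁻ r, (exponentialPDF (mu - lam) (r + max x 0)
          * exponentialPDF lam (r + max (-x) 0) * exponentialPDF mu s)
            * H s (r + max x 0) (r + max (-x) 0) := by
    intro H hH
    have m1 : Measurable fun p : ℝ × ℝ => ∫⁻ a, H p.1 p.2 a ∂(expMeasure lam) :=
      Measurable.lintegral_prod_right' (f := fun q : (ℝ × ℝ) × ℝ => H q.1.1 q.1.2 q.2)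
        (hH.comp (by fun_prop : Measurable fun q : (ℝ × ℝ) × ℝ => (q.1.1, q.1.2, q.2)))
    have m2 : Measurable fun s => ∫⁻ S, ∫⁻ a, H s S a ∂(expMeasure lam) ∂(expMeasure (mu - lam)) :=
      Measurable.lintegral_prod_right' m1
    rw [lintegral_expMeasure _ m2]
    refine lintegral_congr fun s => ?_
    have m3 : ∀ S, Measurable fun a => H s S a := fun S =>
      hH.comp (by fun_prop : Measurable fun a : ℝ => (s, S, a))
    have m6 : Measurable fun S => ∫⁻ a, H s S a ∂(expMeasure lam) :=
      m1.comp measurable_prodMk_left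
    rw [lintegral_expMeasure _ m6]
    have m4 : Measurable (Function.uncurry fun S a => (exponentialPDF (mu - lam) S
        * exponentialPDF lam a * exponentialPDF mu s) * H s S a) := by
      refine Measurable.mul (by fun_prop) ?_
      exact hH.comp (by fun_prop : Measurable fun p : ℝ × ℝ => (s, p.1, p.2))
    rw [← lintegral_lintegral_sub_min m4, ← lintegral_const_mul]
    · refine lintegral_congr fun S => ?_
      rw [lintegral_expMeasure _ (m3 S), ← lintegral_const_mul, ← lintegral_const_mul]
      · refine lintegral_congr fun a => ?_
        ring
      · exact ((measurable_exponentialPDF lam).mul (m3 S)).const_mul _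
      · exact (measurable_exponentialPDF lam).mul (m3 S)
    · exact (measurable_exponentialPDF _).mul m6
  have lhs : ∫⁻ t, ∫⁻ e, G (stepOutput t e) (nextSojourn t e) ∂(gapService lam mu)
        ∂(expMeasure (mu - lam))
      = ∫⁻ s, ∫⁻ S, ∫⁻ a, G (stepOutput S (a, s)) (nextSojourn S (a, s))
          ∂(expMeasure lam) ∂(expMeasure (mu - lam)) ∂(expMeasure mu) := by
    have m : Measurable fun p : ℝ × ℝ × ℝ => G (stepOutput p.1 p.2) (nextSojourn p.1 p.2) :=
      hG.comp ((measurable_fst.stepOutput measurable_snd).prodMk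
        (measurable_fst.nextSojourn measurable_snd))
    rw [lintegral_lintegral_swap (f := fun s S => ∫⁻ a, G (stepOutput S (a, s))
      (nextSojourn S (a, s)) ∂(expMeasure lam))]
    · refine lintegral_congr fun S => ?_
      exact lintegral_prod_symm' _ (m.comp measurable_prodMk_left)
    · refine Measurable.aemeasurable (Measurable.lintegral_prod_right'
        (f := fun q : (ℝ × ℝ) × ℝ => G (stepOutput q.1.2 (q.2, q.1.1))
          (nextSojourn q.1.2 (q.2, q.1.1))) ?_)
      exact m.comp (by fun_prop : Measurable fun q : (ℝ × ℝ) × ℝ => (q.1.2, q.2, q.1.1))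
  have rhs : ∫⁻ o, ∫⁻ t, G o t ∂(expMeasure (mu - lam)) ∂(gapService lam mu)
      = ∫⁻ s, ∫⁻ S, ∫⁻ a, G (a, s) S ∂(expMeasure lam) ∂(expMeasure (mu - lam))
          ∂(expMeasure mu) := by
    rw [gapService, lintegral_prod_symm' _ hG.lintegral_prod_right]
    refine lintegral_congr fun s => lintegral_lintegral_swap (Measurable.aemeasurable ?_)
    exact hG.comp (by fun_prop : Measurable fun q : ℝ × ℝ => ((q.1, s), q.2))
  rw [lhs, rhs, expand, expand]
  · -- exchanging the names of `r` and `s`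
    have m5 : Measurable fun p : ℝ × ℝ × ℝ => (exponentialPDF (mu - lam) (p.2.2 + max p.2.1 0)
          * exponentialPDF lam (p.2.2 + max (-p.2.1) 0) * exponentialPDF mu p.1)
            * G (stepOutput (p.2.2 + max p.2.1 0) (p.2.2 + max (-p.2.1) 0, p.1))
              (nextSojourn (p.2.2 + max p.2.1 0) (p.2.2 + max (-p.2.1) 0, p.1)) := by
      refine Measurable.mul (by fun_prop) ?_
      exact hG.comp (by fun_prop : Measurable fun p : ℝ × ℝ × ℝ =>
        (stepOutput (p.2.2 + max p.2.1 0) (p.2.2 + max (-p.2.1) 0, p.1),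
          nextSojourn (p.2.2 + max p.2.1 0) (p.2.2 + max (-p.2.1) 0, p.1)))
    have swap : ∀ K : ℝ → ℝ → ℝ → ℝ≥0∞, Measurable (fun p : ℝ × ℝ × ℝ => K p.1 p.2.1 p.2.2) →
        ∫⁻ s, ∫⁻ x, ∫⁻ r, K s x r = ∫⁻ s, ∫⁻ x, ∫⁻ r, K r x s := by
      intro K hK
      have e1 : ∫⁻ s, ∫⁻ x, ∫⁻ r, K s x r = ∫⁻ x, ∫⁻ s, ∫⁻ r, K s x r := by
        refine lintegral_lintegral_swap (Measurable.aemeasurable ?_)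
        exact Measurable.lintegral_prod_right' (f := fun q : (ℝ × ℝ) × ℝ => K q.1.1 q.1.2 q.2)
          (hK.comp (by fun_prop : Measurable fun q : (ℝ × ℝ) × ℝ => (q.1.1, q.1.2, q.2)))
      have e2 : ∫⁻ s, ∫⁻ x, ∫⁻ r, K r x s = ∫⁻ x, ∫⁻ s, ∫⁻ r, K r x s := by
        refine lintegral_lintegral_swap (Measurable.aemeasurable ?_)
        exact Measurable.lintegral_prod_right' (f := fun q : (ℝ × ℝ) × ℝ => K q.2 q.1.2 q.1.1)
          (hK.comp (by fun_prop : Measurable fun q : (ℝ × ℝ) × ℝ => (q.2, q.1.2, q.1.1)))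
      rw [e1, e2]
      refine lintegral_congr fun x => lintegral_lintegral_swap (Measurable.aemeasurable ?_)
      exact hK.comp (by fun_prop : Measurable fun q : ℝ × ℝ => (q.1, x, q.2))
    rw [swap _ m5]
    refine lintegral_congr fun s => lintegral_congr fun x => lintegral_congr fun r => ?_
    rw [exponentialPDF_mul_symm hlam hmu x r s]
    congr 2
    · unfold stepOutput
      rcases le_total 0 x with h | h
      · simp [h, add_comm]
      · simp [h, add_comm]
    · unfold nextSojourn
      rcases le_total 0 x with h | h
      · simp [h, add_comm]
      · simp [h, add_comm]
  · exact hG.comp (by fun_prop : Measurable fun p : ℝ × ℝ × ℝ => ((p.2.2, p.1), p.2.1))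
  · exact hG.comp (by fun_prop : Measurable fun p : ℝ × ℝ × ℝ =>
      (stepOutput p.2.1 (p.2.2, p.1), nextSojourn p.2.1 (p.2.2, p.1)))

/-! ### Independent sequences indexed by the integers -/

section IidSequences

variable {ι X Y : Type*} [MeasurableSpace X] [MeasurableSpace Y]

/-- Replacing one coordinate of an i.i.d. family by a fresh copy does not change its law. -/
theorem measurePreserving_update_infinitePi [DecidableEq ι] (ρ : Measure X)
    [IsProbabilityMeasure ρ] (j : ι) :
    MeasurePreserving (fun p : (ι → X) × X => Function.update p.1 j p.2)
      ((Measure.infinitePi fun _ => ρ).prod ρ) (Measure.infinitePi fun _ => ρ) := by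
  have hm : Measurable (fun p : (ι → X) × X => Function.update p.1 j p.2) := by
    refine measurable_pi_lambda _ fun i => ?_
    by_cases h : i = j
    · subst h; simpa using measurable_snd
    · have : Measurable fun p : (ι → X) × X => p.1 i := by fun_prop
      simpa [h] using this
  refine ⟨hm, Measure.eq_infinitePi _ fun s t ht => ?_⟩
  rw [Measure.map_apply hm (.pi s.countable_toSet fun i _ => ht i)]
  by_cases hj : j ∈ s
  · have : (fun p : (ι → X) × X => Function.update p.1 j p.2) ⁻¹' (Set.pi s t)
        = (Set.pi (s.erase j : Finset ι) t) ×ˢ t j := by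
      ext ⟨ω, y⟩
      simp only [Set.mem_preimage, Set.mem_pi, Finset.mem_coe, Set.mem_prod, Finset.mem_erase]
      constructor
      · intro h
        refine ⟨fun i hi => ?_, by simpa using h j hj⟩
        simpa [hi.1] using h i hi.2
      · rintro ⟨h1, h2⟩ i hi
        by_cases hij : i = j
        · subst hij; simpa using h2
        · simpa [hij] using h1 i ⟨hij, hi⟩
    rw [this, Measure.prod_prod, Measure.infinitePi_pi _ fun i _ => ht i,
      Finset.prod_erase_mul _ _ hj]
  · have : (fun p : (ι → X) × X => Function.update p.1 j p.2) ⁻¹' (Set.pi s t)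
        = (Set.pi (s : Set ι) t) ×ˢ Set.univ := by
      ext ⟨ω, y⟩
      simp only [Set.mem_preimage, Set.mem_pi, Finset.mem_coe, Set.mem_prod, Set.mem_univ, and_true]
      refine forall₂_congr fun i hi => ?_
      rw [Function.update_of_ne (by rintro rfl; exact hj hi)]
    rw [this, Measure.prod_prod, Measure.infinitePi_pi _ fun i _ => ht i, measure_univ, mul_one]

theorem lintegral_infinitePi_update [DecidableEq ι] (ρ : Measure X)
    [IsProbabilityMeasure ρ] (j : ι) {G : (ι → X) → ℝ≥0∞} (hG : Measurable G) :
    ∫⁻ ω, G ω ∂(Measure.infinitePi fun _ => ρ)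
      = ∫⁻ ω, ∫⁻ y, G (Function.update ω j y) ∂ρ ∂(Measure.infinitePi fun _ => ρ) := by
  have h := measurePreserving_update_infinitePi ρ j
  rw [← h.lintegral_comp hG]
  exact lintegral_prod _ (hG.comp h.measurable).aemeasurable

theorem measurePreserving_zip_infinitePi (ρ : Measure X) (ν : Measure Y)
    [IsProbabilityMeasure ρ] [IsProbabilityMeasure ν] :
    MeasurePreserving (fun (p : (ι → X) × (ι → Y)) i => (p.1 i, p.2 i))
      ((Measure.infinitePi fun _ => ρ).prod (Measure.infinitePi fun _ => ν))
      (Measure.infinitePi fun _ => ρ.prod ν) := by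
  have hm : Measurable (fun (p : (ι → X) × (ι → Y)) i => (p.1 i, p.2 i)) := by fun_prop
  refine ⟨hm, Measure.eq_infinitePi _ fun s t ht => ?_⟩
  have hms : MeasurableSet (Set.pi (s : Set ι) t) := .pi s.countable_toSet fun i _ => ht i
  rw [Measure.map_apply hm hms, Measure.prod_apply_symm (hm hms)]
  have inner : ∀ b : ι → Y, (Measure.infinitePi fun _ => ρ) ((fun a => (a, b)) ⁻¹'
      ((fun (p : (ι → X) × (ι → Y)) i => (p.1 i, p.2 i)) ⁻¹' (Set.pi s t)))
      = ∏ i ∈ s, ρ ((fun x => (x, b i)) ⁻¹' t i) := by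
    intro b
    rw [← Measure.infinitePi_pi _ fun i _ => measurable_prodMk_right (ht i)]
    rfl
  simp_rw [inner]
  have hX : ∀ i, Measurable fun y => ρ ((fun x => (x, y)) ⁻¹' t i) :=
    fun i => measurable_measure_prodMk_right (ht i)
  have hind : iIndepFun (fun (i : ι) (b : ι → Y) => ρ ((fun x => (x, b i)) ⁻¹' t i))
      (Measure.infinitePi fun _ => ν) :=
    iIndepFun_infinitePi (X := fun i y => ρ ((fun x => (x, y)) ⁻¹' t i)) hX
  rw [lintegral_prod_eq_prod_lintegral_of_indepFun s _ hind
    (fun i => (hX i).comp (measurable_pi_apply i))]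
  refine Finset.prod_congr rfl fun i _ => ?_
  rw [Measure.prod_apply_symm (ht i)]
  exact (measurePreserving_eval_infinitePi (fun _ => ν) i).lintegral_comp (hX i)

theorem measurePreserving_shift_infinitePi (ρ : Measure X) [IsProbabilityMeasure ρ] (j : ℤ) :
    MeasurePreserving (fun (ω : ℤ → X) n => ω (n + j)) (Measure.infinitePi fun _ => ρ)
      (Measure.infinitePi fun _ => ρ) :=
  ⟨by fun_prop, Measure.map_infinitePi_infinitePi_of_inj (P := fun _ => ρ) (add_left_injective j)⟩

/-- The strong law of large numbers along an injective sequence of coordinates. -/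
theorem ae_tendsto_average_infinitePi (ρ : Measure X) [IsProbabilityMeasure ρ] {f : X → ℝ}
    (hfm : Measurable f) (hf : Integrable f ρ) {j : ℕ → ι} (hj : Function.Injective j) :
    ∀ᵐ ω ∂(Measure.infinitePi fun _ : ι => ρ),
      Tendsto (fun n : ℕ => (∑ i ∈ Finset.range n, f (ω (j i))) / n) atTop (𝓝 (∫ x, f x ∂ρ)) := by
  have hev := measurePreserving_eval_infinitePi (fun _ : ι => ρ)
  have hfe : ∀ i, Measurable fun ω : ι → X => f (ω i) :=
    fun i => hfm.comp (measurable_pi_apply i)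
  have hlaw : ∀ i, Measure.map (fun ω : ι → X => f (ω i)) (Measure.infinitePi fun _ => ρ)
      = ρ.map f := fun i =>
    (Measure.map_map hfm (measurable_pi_apply i)).symm.trans
      (congrArg (Measure.map f) (hev i).map_eq)
  have h := strong_law_ae_real (μ := Measure.infinitePi fun _ : ι => ρ)
    (fun i ω => f (ω (j i))) ((hev (j 0)).integrable_comp_of_integrable hf)
    (fun a b hab => (iIndepFun_infinitePi (P := fun _ : ι => ρ) (X := fun _ => f)
      fun _ => hfm).indepFun (hj.ne hab))
    (fun i => ⟨(hfe _).aemeasurable, (hfe _).aemeasurable, by rw [hlaw, hlaw]⟩)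
  have hint : ∫ ω, f (ω (j 0)) ∂(Measure.infinitePi fun _ : ι => ρ) = ∫ x, f x ∂ρ := by
    calc _ = ∫ x, f x ∂(Measure.map (Function.eval (j 0)) (Measure.infinitePi fun _ : ι => ρ)) :=
          (integral_map (measurable_pi_apply _).aemeasurable hfm.aestronglyMeasurable).symm
      _ = _ := by rw [(hev (j 0)).map_eq]
  rw [hint] at h
  exact h

end IidSequences

/-! ### Random walks indexed by the integers, and stability -/

/-- The points on the line with successive gaps `a`, the point with index `0` being the origin. -/
noncomputable def pointsOfGaps (a : ℤ → ℝ) (n : ℤ) : ℝ :=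
  ∑ i ∈ Finset.Ico 0 n, a i - ∑ i ∈ Finset.Ico n 0, a i

@[simp]
theorem pointsOfGaps_zero (a : ℤ → ℝ) : pointsOfGaps a 0 = 0 := by simp [pointsOfGaps]

theorem pointsOfGaps_add_one (a : ℤ → ℝ) (n : ℤ) :
    pointsOfGaps a (n + 1) = pointsOfGaps a n + a n := by
  unfold pointsOfGaps
  rcases le_or_gt 0 n with h | h
  · have e : Finset.Ico 0 (n + 1) = insert n (Finset.Ico 0 n) := by
      ext i; simp only [Finset.mem_Ico, Finset.mem_insert]; omega
    rw [e, Finset.sum_insert (by simp), Finset.Ico_eq_empty (a := n) (b := 0) (by omega),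
      Finset.Ico_eq_empty (a := n + 1) (b := 0) (by omega)]
    simp only [Finset.sum_empty]; ring
  · have e : Finset.Ico n 0 = insert n (Finset.Ico (n + 1) 0) := by
      ext i; simp only [Finset.mem_Ico, Finset.mem_insert]; omega
    rw [e, Finset.sum_insert (by simp), Finset.Ico_eq_empty (a := 0) (b := n) (by omega),
      Finset.Ico_eq_empty (a := 0) (b := n + 1) (by omega)]
    simp only [Finset.sum_empty]; ring

/-- A sequence is determined by its increments and one value. -/
theorem eq_pointsOfGaps_add {x : ℤ → ℝ} {a : ℤ → ℝ} (h : ∀ n, x (n + 1) = x n + a n) (n : ℤ) :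
    x n = x 0 + pointsOfGaps a n := by
  induction n using Int.induction_on with
  | zero => simp
  | succ n ih => rw [h, ih, pointsOfGaps_add_one]; ring
  | pred n ih =>
    have h1 := h (-(n : ℤ) - 1)
    have h2 := pointsOfGaps_add_one a (-(n : ℤ) - 1)
    rw [sub_add_cancel] at h1 h2
    linarith

theorem pointsOfGaps_shift (a : ℤ → ℝ) (j n : ℤ) :
    pointsOfGaps (fun i => a (i + j)) n = pointsOfGaps a (n + j) - pointsOfGaps a j := by
  have := eq_pointsOfGaps_add (x := fun n => pointsOfGaps a (n + j)) (a := fun i => a (i + j))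
    (fun n => by rw [← pointsOfGaps_add_one]; congr 1; ring) n
  simp only [zero_add] at this
  linarith

theorem pointsOfGaps_natCast (a : ℤ → ℝ) (n : ℕ) :
    pointsOfGaps a n = ∑ i ∈ Finset.range n, a i := by
  induction n with
  | zero => simp
  | succ n ih => rw [Finset.sum_range_succ, ← ih, Nat.cast_succ, pointsOfGaps_add_one]

theorem pointsOfGaps_neg_natCast (a : ℤ → ℝ) (n : ℕ) :
    pointsOfGaps a (-n) = -∑ i ∈ Finset.range n, a (-(i : ℤ) - 1) := by
  induction n with
  | zero => simp
  | succ n ih =>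
    have h2 := pointsOfGaps_add_one a (-(n : ℤ) - 1)
    rw [sub_add_cancel, ih] at h2
    rw [Finset.sum_range_succ, Nat.cast_succ, show -((n : ℤ) + 1) = -(n : ℤ) - 1 by ring]
    linarith

theorem Int.sum_Icc_neg_natCast (s : ℤ → ℝ) (n : ℕ) :
    ∑ i ∈ Finset.Icc (-(n : ℤ)) 0, s i = ∑ i ∈ Finset.range (n + 1), s (-(i : ℤ)) := by
  induction n with
  | zero => simp
  | succ n ih =>
    have e : Finset.Icc (-((n + 1 : ℕ) : ℤ)) 0
        = insert (-((n + 1 : ℕ) : ℤ)) (Finset.Icc (-(n : ℤ)) 0) := by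
      ext i; simp only [Finset.mem_Icc, Finset.mem_insert]; push_cast; omega
    rw [e, Finset.sum_insert (by simp), ih, Finset.sum_range_succ _ (n + 1), add_comm]

@[fun_prop]
theorem Measurable.pointsOfGaps {α : Type*} [MeasurableSpace α] {a : ℤ → α → ℝ}
    (ha : ∀ i, Measurable (a i)) (n : ℤ) : Measurable fun x => pointsOfGaps (fun i => a i x) n :=
  (Finset.measurable_sum _ fun i _ => ha i).sub (Finset.measurable_sum _ fun i _ => ha i)

theorem pointsOfGaps_congr {a b : ℤ → ℝ} {n : ℤ} (hn : 0 ≤ n)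
    (h : ∀ i, 0 ≤ i → i < n → a i = b i) : pointsOfGaps a n = pointsOfGaps b n := by
  unfold pointsOfGaps
  rw [Finset.Ico_eq_empty (a := n) (b := 0) (by omega)]
  congr 1
  exact Finset.sum_congr rfl fun i hi => h i (Finset.mem_Ico.1 hi).1 (Finset.mem_Ico.1 hi).2

theorem strictMono_pointsOfGaps {a : ℤ → ℝ} (ha : ∀ i, 0 < a i) : StrictMono (pointsOfGaps a) :=
  strictMono_int_of_lt_succ fun n => by rw [pointsOfGaps_add_one]; linarith [ha n]

theorem tendsto_int_atTop_of_nat {f : ℤ → ℝ} {l : Filter ℝ}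
    (h : Tendsto (fun n : ℕ => f n) atTop l) : Tendsto f atTop l := by
  have h1 : Tendsto Int.toNat atTop atTop :=
    Filter.tendsto_atTop.2 fun b => (eventually_ge_atTop (b : ℤ)).mono fun k hk => by omega
  refine (h.comp h1).congr' ?_
  filter_upwards [eventually_ge_atTop (0 : ℤ)] with k hk
  simp [Int.toNat_of_nonneg hk]

theorem tendsto_int_atBot_of_nat {f : ℤ → ℝ} {l : Filter ℝ}
    (h : Tendsto (fun n : ℕ => f (-n)) atTop l) : Tendsto f atBot l := by
  have := (tendsto_int_atTop_of_nat (f := fun k => f (-k)) h).comp tendsto_neg_atBot_atTop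
  refine this.congr fun k => ?_
  simp

theorem tendsto_atTop_of_average {f : ℕ → ℝ} {c : ℝ} (hc : 0 < c)
    (h : Tendsto (fun n : ℕ => f n / n) atTop (𝓝 c)) : Tendsto f atTop atTop := by
  have := h.pos_mul_atTop hc (tendsto_natCast_atTop_atTop (R := ℝ))
  refine this.congr' ?_
  filter_upwards [eventually_gt_atTop 0] with n hn
  field_simp

/-- The law of the gaps and service times, indexed by `ℤ`. -/
noncomputable def gapServiceSeq (lam mu : ℝ) : Measure (ℤ → ℝ × ℝ) :=
  Measure.infinitePi fun _ => gapService lam mu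

section Stability

variable {lam mu : ℝ}

theorem isProbabilityMeasure_gapServiceSeq (hlam : 0 < lam) (hmu : 0 < mu) :
    IsProbabilityMeasure (gapServiceSeq lam mu) := by
  have := isProbabilityMeasure_gapService hlam hmu
  unfold gapServiceSeq; infer_instance

theorem integral_fst_gapService (hlam : 0 < lam) (hmu : 0 < mu) :
    ∫ e, e.1 ∂(gapService lam mu) = lam⁻¹ := by
  have := isProbabilityMeasure_expMeasure hlam
  have := isProbabilityMeasure_expMeasure hmu
  rw [gapService, integral_fun_fst (fun x : ℝ => x), integral_id_expMeasure hlam]; simp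

theorem integral_snd_gapService (hlam : 0 < lam) (hmu : 0 < mu) :
    ∫ e, e.2 ∂(gapService lam mu) = mu⁻¹ := by
  have := isProbabilityMeasure_expMeasure hlam
  have := isProbabilityMeasure_expMeasure hmu
  rw [gapService, integral_fun_snd (fun x : ℝ => x), integral_id_expMeasure hmu]; simp

theorem integrable_fst_gapService (hlam : 0 < lam) (hmu : 0 < mu) :
    Integrable (fun e : ℝ × ℝ => e.1) (gapService lam mu) := by
  have := isProbabilityMeasure_expMeasure hlam
  have := isProbabilityMeasure_expMeasure hmu
  exact (integrable_id_expMeasure hlam).comp_fst _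

theorem integrable_snd_gapService (hlam : 0 < lam) (hmu : 0 < mu) :
    Integrable (fun e : ℝ × ℝ => e.2) (gapService lam mu) := by
  have := isProbabilityMeasure_expMeasure hlam
  have := isProbabilityMeasure_expMeasure hmu
  exact (integrable_id_expMeasure hmu).comp_snd _

theorem ae_pos_gapServiceSeq (hlam : 0 < lam) (hmu : 0 < mu) :
    ∀ᵐ ω ∂(gapServiceSeq lam mu), ∀ i, 0 < (ω i).1 ∧ 0 < (ω i).2 := by
  have := isProbabilityMeasure_expMeasure hlam
  have := isProbabilityMeasure_expMeasure hmu
  have := isProbabilityMeasure_gapService hlam hmu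
  refine ae_all_iff.2 fun i => ?_
  have h : ∀ᵐ e ∂(gapService lam mu), 0 < e.1 ∧ 0 < e.2 :=
    (Measure.quasiMeasurePreserving_fst.ae (ae_pos_expMeasure lam)).and
      (Measure.quasiMeasurePreserving_snd.ae (ae_pos_expMeasure mu))
  exact (measurePreserving_eval_infinitePi (fun _ : ℤ => gapService lam mu)
    i).quasiMeasurePreserving.ae h

/-- The arrival instants with gaps `(ω i).1`, customer `0` arriving at time `0`. -/
noncomputable def palmArrival (ω : ℤ → ℝ × ℝ) : ℤ → ℝ := pointsOfGaps fun i => (ω i).1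

/-- The service times read off from `ω`. The gap `(ω i).1` between the customers `i` and `i + 1`
is paired with the service time of customer `i + 1`, so that `ω i` is exactly the new input of the
queue in the step from customer `i` to customer `i + 1`. -/
noncomputable def palmService (ω : ℤ → ℝ × ℝ) (n : ℤ) : ℝ := (ω (n - 1)).2

/-- The work brought in, minus the time elapsed, has negative drift. -/
theorem ae_tendsto_netInput_atBot (hlam : 0 < lam) (hmu : lam < mu) :
    ∀ᵐ ω ∂(gapServiceSeq lam mu),
      Tendsto (fun n : ℕ => ∑ i ∈ Finset.range n, ((ω i).2 - (ω i).1)) atTop atBot := by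
  have hmu0 := hlam.trans hmu
  have := isProbabilityMeasure_gapService hlam hmu0
  have h := ae_tendsto_average_infinitePi (gapService lam mu) (f := fun e => e.1 - e.2)
    (by fun_prop) ((integrable_fst_gapService hlam hmu0).sub (integrable_snd_gapService hlam hmu0))
    (j := fun n : ℕ => (n : ℤ)) Nat.cast_injective
  rw [integral_sub (integrable_fst_gapService hlam hmu0) (integrable_snd_gapService hlam hmu0),
    integral_fst_gapService hlam hmu0, integral_snd_gapService hlam hmu0] at h
  filter_upwards [h] with ω hω
  refine (tendsto_neg_atTop_atBot.comp (tendsto_atTop_of_average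
    (sub_pos.2 (inv_strictAnti₀ hlam hmu)) hω)).congr fun n => ?_
  simp only [Function.comp]
  rw [← Finset.sum_neg_distrib]
  exact Finset.sum_congr rfl fun i _ => by ring

theorem ae_stableInput (hlam : 0 < lam) (hmu : lam < mu) :
    ∀ᵐ ω ∂(gapServiceSeq lam mu), StableInput (palmArrival ω) (palmService ω) := by
  have hmu0 := hlam.trans hmu
  have := isProbabilityMeasure_gapService hlam hmu0
  have inj : Function.Injective fun n : ℕ => -(n : ℤ) - 1 := fun a b h => by
    simp only at h; omega
  have h1 := ae_tendsto_average_infinitePi (gapService lam mu) (f := fun e => e.1)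
    (by fun_prop) (integrable_fst_gapService hlam hmu0)
    (j := fun n : ℕ => (n : ℤ)) Nat.cast_injective
  have h2 := ae_tendsto_average_infinitePi (gapService lam mu) (f := fun e => e.1)
    (by fun_prop) (integrable_fst_gapService hlam hmu0) inj
  have h3 := ae_tendsto_average_infinitePi (gapService lam mu) (f := fun e => e.2)
    (by fun_prop) (integrable_snd_gapService hlam hmu0) inj
  rw [integral_fst_gapService hlam hmu0] at h1 h2
  rw [integral_snd_gapService hlam hmu0] at h3
  filter_upwards [h1, h2, h3, ae_pos_gapServiceSeq hlam hmu0] with ω h1 h2 h3 hpos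
  have top : Tendsto (palmArrival ω) atTop atTop := by
    refine tendsto_int_atTop_of_nat ?_
    refine (tendsto_atTop_of_average (inv_pos.2 hlam) h1).congr fun n => ?_
    rw [palmArrival, pointsOfGaps_natCast]
  have bot : Tendsto (palmArrival ω) atBot atBot := by
    refine tendsto_int_atBot_of_nat ?_
    refine (tendsto_neg_atTop_atBot.comp
      (tendsto_atTop_of_average (inv_pos.2 hlam) h2)).congr fun n => ?_
    rw [palmArrival, pointsOfGaps_neg_natCast]; rfl
  refine ⟨strictMono_pointsOfGaps fun i => (hpos i).1, top, bot, fun n => (hpos _).2, ?_⟩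
  refine tendsto_int_atBot_of_nat ?_
  -- the number of service times exceeds the number of gaps by one
  have h4 : Tendsto (fun n : ℕ => (∑ i ∈ Finset.range (n + 1), (ω (-(i : ℤ) - 1)).2) / n) atTop
      (𝓝 mu⁻¹) := by
    have h5 := (h3.comp (tendsto_add_atTop_nat 1)).mul
      ((tendsto_const_nhds (x := (1 : ℝ))).add (tendsto_one_div_atTop_nhds_zero_nat (𝕜 := ℝ)))
    rw [add_zero, mul_one] at h5
    refine h5.congr' ?_
    filter_upwards [eventually_gt_atTop 0] with n hn
    have : (n : ℝ) ≠ 0 := by positivity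
    simp only [Function.comp, Nat.cast_add, Nat.cast_one]
    field_simp
  have h6 := tendsto_atTop_of_average (sub_pos.2 (inv_strictAnti₀ hlam hmu))
    (f := fun n => ∑ i ∈ Finset.range n, (ω (-(i : ℤ) - 1)).1
      - ∑ i ∈ Finset.range (n + 1), (ω (-(i : ℤ) - 1)).2)
    ((h2.sub h4).congr fun n => by rw [sub_div])
  refine (tendsto_neg_atTop_atBot.comp h6).congr fun n => ?_
  rw [palmArrival, pointsOfGaps_neg_natCast, Int.sum_Icc_neg_natCast]
  simp only [palmService, Function.comp]
  ring

end Stability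

/-! ### Burke's theorem seen from a typical customer -/

section PalmBurke

/-- The sojourn time of customer `n` when customer `0` has sojourn time `t`. -/
noncomputable def iterSojourn (t : ℝ) (ω : ℤ → ℝ × ℝ) : ℕ → ℝ
  | 0 => t
  | n + 1 => nextSojourn (iterSojourn t ω n) (ω n)

theorem measurable_iterSojourn (n : ℕ) :
    Measurable fun p : ℝ × (ℤ → ℝ × ℝ) => iterSojourn p.1 p.2 n := by
  induction n with
  | zero => exact measurable_fst
  | succ n ih =>
    have : Measurable fun p : ℝ × (ℤ → ℝ × ℝ) => p.2 n := by fun_prop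
    exact ih.nextSojourn this

theorem iterSojourn_update (t : ℝ) (ω : ℤ → ℝ × ℝ) (n : ℕ) (y : ℝ × ℝ) {j : ℕ} (hj : j ≤ n) :
    iterSojourn t (Function.update ω n y) j = iterSojourn t ω j := by
  induction j with
  | zero => rfl
  | succ j ih =>
    rw [iterSojourn, iterSojourn, ih (by omega), Function.update_of_ne (by simp; omega)]

/-- The output of the step from customer `n` to customer `n + 1` when customer `0` has sojourn
time `t`. -/
noncomputable def iterOutput (t : ℝ) (ω : ℤ → ℝ × ℝ) (n : ℕ) : ℝ × ℝ :=
  stepOutput (iterSojourn t ω n) (ω n)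

theorem measurable_iterOutput (n : ℕ) :
    Measurable fun p : ℝ × (ℤ → ℝ × ℝ) => iterOutput p.1 p.2 n := by
  have : Measurable fun p : ℝ × (ℤ → ℝ × ℝ) => p.2 n := by fun_prop
  exact (measurable_iterSojourn n).stepOutput this

variable {lam mu : ℝ}

/-- If customer `0` has an exponential sojourn time of parameter `mu - lam`, then the outputs of
the first `n` steps and the sojourn time of customer `n` are independent. -/
theorem lintegral_prod_iterOutput (hlam : 0 < lam) (hmu : lam < mu) {f : ℕ → ℝ × ℝ → ℝ≥0∞}
    (hf : ∀ j, Measurable (f j)) (n : ℕ) {g : ℝ → ℝ≥0∞} (hg : Measurable g) :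
    ∫⁻ t, ∫⁻ ω, (∏ j ∈ Finset.range n, f j (iterOutput t ω j)) * g (iterSojourn t ω n)
        ∂(gapServiceSeq lam mu) ∂(expMeasure (mu - lam))
      = (∏ j ∈ Finset.range n, ∫⁻ e, f j e ∂(gapService lam mu))
        * ∫⁻ t, g t ∂(expMeasure (mu - lam)) := by
  have := isProbabilityMeasure_gapService hlam (hlam.trans hmu)
  have := isProbabilityMeasure_gapServiceSeq hlam (hlam.trans hmu)
  have := isProbabilityMeasure_expMeasure (sub_pos.2 hmu)
  induction n generalizing g with
  | zero => simp [iterSojourn]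
  | succ n ih =>
    -- the input of the last step is integrated out first
    let Lg : ℝ → ℝ≥0∞ := fun t =>
      ∫⁻ e, f n (stepOutput t e) * g (nextSojourn t e) ∂(gapService lam mu)
    have hLg' : Measurable fun p : ℝ × ℝ × ℝ =>
        f n (stepOutput p.1 p.2) * g (nextSojourn p.1 p.2) :=
      ((hf n).comp (measurable_fst.stepOutput measurable_snd)).mul
        (hg.comp (measurable_fst.nextSojourn measurable_snd))
    have hLg : Measurable Lg := hLg'.lintegral_prod_right'
    have step : ∀ t, ∫⁻ ω, (∏ j ∈ Finset.range (n + 1), f j (iterOutput t ω j))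
          * g (iterSojourn t ω (n + 1)) ∂(gapServiceSeq lam mu)
        = ∫⁻ ω, (∏ j ∈ Finset.range n, f j (iterOutput t ω j)) * Lg (iterSojourn t ω n)
          ∂(gapServiceSeq lam mu) := by
      intro t
      have hm : Measurable fun ω => (∏ j ∈ Finset.range (n + 1), f j (iterOutput t ω j))
          * g (iterSojourn t ω (n + 1)) := by
        refine Measurable.mul (Finset.measurable_fun_prod _ fun j _ => ?_) ?_
        · exact (hf j).comp ((measurable_iterOutput j).comp measurable_prodMk_left)
        · exact hg.comp ((measurable_iterSojourn (n + 1)).comp measurable_prodMk_left)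
      rw [gapServiceSeq, lintegral_infinitePi_update _ (n : ℤ) hm]
      refine lintegral_congr fun ω => ?_
      have hm2 : Measurable fun y => f n (stepOutput (iterSojourn t ω n) y)
          * g (nextSojourn (iterSojourn t ω n) y) := hLg'.comp measurable_prodMk_left
      simp only [Lg]
      rw [← lintegral_const_mul _ hm2]
      refine lintegral_congr fun y => ?_
      rw [Finset.prod_range_succ, iterSojourn, iterOutput, iterSojourn_update _ _ _ _ le_rfl,
        Function.update_self, mul_assoc]
      congr 1
      refine Finset.prod_congr rfl fun j hj => ?_
      rw [Finset.mem_range] at hj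
      rw [iterOutput, iterOutput, iterSojourn_update _ _ _ _ hj.le,
        Function.update_of_ne (by simp; omega)]
    simp_rw [step]
    rw [ih hLg, lintegral_queueStep hlam hmu (G := fun o t => f n o * g t)
      (((hf n).comp measurable_fst).mul (hg.comp measurable_snd)), Finset.prod_range_succ,
      mul_assoc]
    congr 1
    simp_rw [lintegral_const_mul _ hg]
    rw [lintegral_mul_const _ (hf n)]

theorem measure_iterOutput_mem (hlam : 0 < lam) (hmu : lam < mu) (s : Finset ℕ)
    {B : ℕ → Set (ℝ × ℝ)} (hB : ∀ j, MeasurableSet (B j)) :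
    ((expMeasure (mu - lam)).prod (gapServiceSeq lam mu)) {p | ∀ j ∈ s, iterOutput p.1 p.2 j ∈ B j}
      = ∏ j ∈ s, gapService lam mu (B j) := by
  have := isProbabilityMeasure_gapService hlam (hlam.trans hmu)
  have := isProbabilityMeasure_gapServiceSeq hlam (hlam.trans hmu)
  have := isProbabilityMeasure_expMeasure (sub_pos.2 hmu)
  have hsub : s ⊆ Finset.range (s.sup id + 1) := fun j hj =>
    Finset.mem_range.2 (Nat.lt_succ_of_le (Finset.le_sup (f := id) hj))
  let f : ℕ → ℝ × ℝ → ℝ≥0∞ := fun j => (if j ∈ s then B j else Set.univ).indicator 1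
  have hf : ∀ j, Measurable (f j) := fun j => by
    refine measurable_one.indicator ?_
    split_ifs
    exacts [hB j, .univ]
  have hms : MeasurableSet {p : ℝ × (ℤ → ℝ × ℝ) | ∀ j ∈ s, iterOutput p.1 p.2 j ∈ B j} := by
    have : {p : ℝ × (ℤ → ℝ × ℝ) | ∀ j ∈ s, iterOutput p.1 p.2 j ∈ B j}
        = ⋂ j ∈ s, (fun p : ℝ × (ℤ → ℝ × ℝ) => iterOutput p.1 p.2 j) ⁻¹' B j := by
      ext; simp
    rw [this]
    exact Finset.measurableSet_biInter _ fun j _ => measurable_iterOutput j (hB j)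
  have h := lintegral_prod_iterOutput hlam hmu hf (s.sup id + 1) (g := fun _ => 1) measurable_const
  simp only [mul_one, lintegral_const, measure_univ] at h
  rw [← lintegral_indicator_one hms, lintegral_prod _ (measurable_one.indicator hms).aemeasurable]
  have e1 : ∀ t ω, {p : ℝ × (ℤ → ℝ × ℝ) | ∀ j ∈ s, iterOutput p.1 p.2 j ∈ B j}.indicator
      (1 : ℝ × (ℤ → ℝ × ℝ) → ℝ≥0∞) (t, ω)
      = ∏ j ∈ Finset.range (s.sup id + 1), f j (iterOutput t ω j) := by
    intro t ω
    rw [← Finset.prod_subset hsub (fun j _ hj => by simp [f, hj])]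
    by_cases hp : ∀ j ∈ s, iterOutput t ω j ∈ B j
    · rw [Set.indicator_of_mem (show (t, ω) ∈ {p : ℝ × (ℤ → ℝ × ℝ) |
        ∀ j ∈ s, iterOutput p.1 p.2 j ∈ B j} from hp), Finset.prod_eq_one]
      · rfl
      · intro j hj
        simp [f, hj, hp j hj]
    · rw [Set.indicator_of_notMem (show (t, ω) ∉ {p : ℝ × (ℤ → ℝ × ℝ) |
        ∀ j ∈ s, iterOutput p.1 p.2 j ∈ B j} from hp)]
      push Not at hp
      obtain ⟨j, hj, hjB⟩ := hp
      exact (Finset.prod_eq_zero hj (by simp [f, hj, hjB])).symm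
  simp_rw [e1]
  rw [h, ← Finset.prod_subset hsub (fun j _ hj => by simp [f, hj])]
  refine Finset.prod_congr rfl fun j hj => ?_
  simp only [f, hj, if_true]
  exact lintegral_indicator_one (hB j)

theorem measure_iterSojourn_mem (hlam : 0 < lam) (hmu : lam < mu) (n : ℕ)
    {B : Set ℝ} (hB : MeasurableSet B) :
    ((expMeasure (mu - lam)).prod (gapServiceSeq lam mu)) {p | iterSojourn p.1 p.2 n ∈ B}
      = expMeasure (mu - lam) B := by
  have := isProbabilityMeasure_gapService hlam (hlam.trans hmu)
  have := isProbabilityMeasure_gapServiceSeq hlam (hlam.trans hmu)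
  have hms : MeasurableSet {p : ℝ × (ℤ → ℝ × ℝ) | iterSojourn p.1 p.2 n ∈ B} :=
    measurable_iterSojourn n hB
  have h := lintegral_prod_iterOutput hlam hmu (f := fun _ _ => 1) (fun _ => measurable_const) n
    (g := B.indicator 1) (measurable_one.indicator hB)
  simp only [Finset.prod_const_one, one_mul, lintegral_const, measure_univ,
    lintegral_indicator_one hB] at h
  rw [← lintegral_indicator_one hms, lintegral_prod _ (measurable_one.indicator hms).aemeasurable,
    ← h]
  rfl

/-- Two queues with the same input and different initial sojourn times eventually agree. -/
theorem eventually_eq_of_nextSojourn {T U : ℕ → ℝ} {e : ℕ → ℝ × ℝ}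
    (hT : ∀ n, T (n + 1) = nextSojourn (T n) (e n)) (hU : ∀ n, U (n + 1) = nextSojourn (U n) (e n))
    (hpos : ∀ n, 0 < (e n).2)
    (hdrift : Tendsto (fun n : ℕ => ∑ i ∈ Finset.range n, ((e i).2 - (e i).1)) atTop atBot) :
    ∀ᶠ n in atTop, T n = U n := by
  by_contra hcon
  have hne : ∀ n, T n ≠ U n := by
    intro n hn
    refine hcon (eventually_atTop.2 ⟨n, fun m hm => ?_⟩)
    induction m, hm using Nat.le_induction with
    | base => exact hn
    | succ m _ ih => rw [hT, hU, ih]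
  -- if the two never meet, the server is never idle for the larger one
  have hmax : ∀ n, max (T n) (U n)
      = max (T 0) (U 0) + ∑ i ∈ Finset.range n, ((e i).2 - (e i).1) := by
    intro n
    induction n with
    | zero => simp
    | succ n ih =>
      rw [Finset.sum_range_succ, ← add_assoc, ← ih]
      have h1 := hne (n + 1)
      rw [hT, hU] at h1 ⊢
      unfold nextSojourn at *
      have h2 : (e n).1 < max (T n) (U n) := by
        by_contra h2
        rw [not_lt, max_le_iff] at h2
        rw [max_eq_right (sub_nonpos.2 h2.1), max_eq_right (sub_nonpos.2 h2.2)] at h1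
        exact h1 rfl
      rw [max_add_add_right, max_max_max_comm, max_self, max_sub_sub_right,
        max_eq_left (sub_nonneg.2 h2.le)]
      ring
  obtain ⟨N, hN⟩ := eventually_atTop.1 (hdrift.eventually_lt_atBot (-max (T 0) (U 0)))
  have h3 := hN (N + 1) (Nat.le_succ N)
  have h4 : 0 < T (N + 1) := by
    rw [hT]; unfold nextSojourn
    linarith [hpos N, le_max_right (T N - (e N).1) 0]
  linarith [hmax (N + 1), le_max_left (T (N + 1)) (U (N + 1))]

/-- Two sequences of events which almost surely agree from some index on, and whose probabilities
are constant, have the same probability. -/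
theorem measure_eq_of_eventually_mem_iff {α : Type*} [MeasurableSpace α] {P : Measure α}
    [IsFiniteMeasure P] {E F : ℕ → Set α} (hE : ∀ n, MeasurableSet (E n))
    (hF : ∀ n, MeasurableSet (F n)) (h : ∀ᵐ x ∂P, ∀ᶠ n in atTop, (x ∈ E n ↔ x ∈ F n))
    {c d : ℝ≥0∞} (hc : ∀ n, P (E n) = c) (hd : ∀ n, P (F n) = d) : c = d := by
  have key : ∀ {E F : ℕ → Set α}, (∀ n, MeasurableSet (E n)) → (∀ n, MeasurableSet (F n)) →
      (∀ᵐ x ∂P, ∀ᶠ n in atTop, (x ∈ E n ↔ x ∈ F n)) → ∀ {c d : ℝ≥0∞}, (∀ n, P (E n) = c) →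
      (∀ n, P (F n) = d) → c ≤ d := by
    intro E F hE hF h c d hc hd
    have hlim : Tendsto (fun n => P (E n \ F n)) atTop (𝓝 (P ∅)) := by
      refine tendsto_measure_of_ae_tendsto_indicator_of_isFiniteMeasure atTop .empty
        (fun n => (hE n).diff (hF n)) ?_
      filter_upwards [h] with x hx
      filter_upwards [hx] with n hn
      simp only [Set.mem_sdiff, Set.mem_empty_iff_false, iff_false]
      tauto
    have hlim2 := (tendsto_const_nhds (x := d)).add hlim
    rw [measure_empty, add_zero] at hlim2
    refine ge_of_tendsto' hlim2 fun n => ?_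
    rw [← hc n, ← hd n]
    exact (measure_mono (by intro x hx; by_cases hxF : x ∈ F n <;> simp [hx, hxF])).trans
      (measure_union_le (F n) (E n \ F n))
  refine le_antisymm (key hE hF h hc hd) (key hF hE ?_ hd hc)
  filter_upwards [h] with x hx
  filter_upwards [hx] with n hn using hn.symm

/-- The departure instants of the queue whose customer `0` arrives at time `0`. -/
noncomputable def palmDeparture (ω : ℤ → ℝ × ℝ) : ℤ → ℝ :=
  departureTime (palmArrival ω) (palmService ω)

/-- The departure gaps and the back times of the queue whose customer `0` arrives at time `0`. -/
noncomputable def palmOutput (ω : ℤ → ℝ × ℝ) (n : ℤ) : ℝ × ℝ :=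
  stepOutput (palmDeparture ω n - palmArrival ω n) (ω n)

theorem measurable_palmArrival (n : ℤ) : Measurable fun ω => palmArrival ω n :=
  Measurable.pointsOfGaps (fun i => by fun_prop) n

theorem measurable_palmService (n : ℤ) : Measurable fun ω => palmService ω n := by
  unfold palmService; fun_prop

theorem measurable_palmDeparture (n : ℤ) : Measurable fun ω => palmDeparture ω n :=
  measurable_departureTime measurable_palmArrival measurable_palmService n

theorem measurable_palmOutput (n : ℤ) : Measurable fun ω => palmOutput ω n :=
  ((measurable_palmDeparture n).sub (measurable_palmArrival n)).stepOutput (by fun_prop)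

theorem palmArrival_add_one (ω : ℤ → ℝ × ℝ) (n : ℤ) :
    palmArrival ω (n + 1) = palmArrival ω n + (ω n).1 := pointsOfGaps_add_one _ n

theorem palmArrival_shift (ω : ℤ → ℝ × ℝ) (j n : ℤ) :
    palmArrival (fun i => ω (i + j)) n = palmArrival ω (n + j) - palmArrival ω j :=
  pointsOfGaps_shift (fun i => (ω i).1) j n

theorem palmDeparture_add_one {ω : ℤ → ℝ × ℝ}
    (h : StableInput (palmArrival ω) (palmService ω)) (n : ℤ) :
    palmDeparture ω (n + 1) = max (palmDeparture ω n) (palmArrival ω (n + 1)) + (ω n).2 := by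
  rw [palmDeparture, h.departureTime_add_one]
  congr 1
  simp [palmService]

theorem palmDeparture_shift {ω : ℤ → ℝ × ℝ}
    (h : StableInput (palmArrival ω) (palmService ω)) (j n : ℤ) :
    palmDeparture (fun i => ω (i + j)) n = palmDeparture ω (n + j) - palmArrival ω j := by
  have e1 : palmService (fun i => ω (i + j)) = fun n => palmService ω (n + j) := by
    ext n; simp only [palmService]; rw [show n - 1 + j = n + j - 1 by ring]
  have e2 : palmArrival (fun i => ω (i + j))
      = fun n => (fun k => palmArrival ω k - palmArrival ω j) (n + j) :=
    funext fun n => palmArrival_shift ω j n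
  rw [palmDeparture, e1, e2, departureTime_shift (fun k => palmArrival ω k - palmArrival ω j),
    h.departureTime_sub]
  rfl

theorem palmSojourn_add_one {ω : ℤ → ℝ × ℝ}
    (h : StableInput (palmArrival ω) (palmService ω)) (n : ℤ) :
    palmDeparture ω (n + 1) - palmArrival ω (n + 1)
      = nextSojourn (palmDeparture ω n - palmArrival ω n) (ω n) := by
  rw [palmDeparture_add_one h, nextSojourn, sub_sub, ← palmArrival_add_one]
  rcases le_total (palmDeparture ω n) (palmArrival ω (n + 1)) with hle | hle
  · rw [max_eq_right hle, max_eq_right (sub_nonpos.2 hle)]; ring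
  · rw [max_eq_left hle, max_eq_left (sub_nonneg.2 hle)]; ring

/-- On a stable input, `palmOutput` has the meaning its name claims. -/
theorem palmOutput_eq {ω : ℤ → ℝ × ℝ}
    (h : StableInput (palmArrival ω) (palmService ω)) (n : ℤ) :
    palmOutput ω n = (palmDeparture ω (n + 1) - palmDeparture ω n,
      min (palmDeparture ω n) (palmArrival ω (n + 1)) - palmArrival ω n) := by
  have hgap : (ω n).1 = palmArrival ω (n + 1) - palmArrival ω n := by
    rw [palmArrival_add_one]; ring
  rw [palmDeparture_add_one h, palmOutput, stepOutput, hgap]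
  rcases le_total (palmDeparture ω n) (palmArrival ω (n + 1)) with hle | hle
  · rw [max_eq_right hle, max_eq_left (by linarith), min_eq_left hle, min_eq_left (by linarith)]
    congr 1; ring
  · rw [max_eq_left hle, max_eq_right (by linarith), min_eq_right hle, min_eq_right (by linarith)]
    congr 1; ring

/-- The queue in equilibrium, seen from the arrival of a typical customer: departure gaps and back
times have the law of arrival gaps and service times. -/
theorem map_palmOutput (hlam : 0 < lam) (hmu : lam < mu) :
    Measure.map palmOutput (gapServiceSeq lam mu) = gapServiceSeq lam mu := by
  have hprob := isProbabilityMeasure_gapService hlam (hlam.trans hmu)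
  have := isProbabilityMeasure_gapServiceSeq hlam (hlam.trans hmu)
  have := isProbabilityMeasure_expMeasure (sub_pos.2 hmu)
  have hmo : Measurable palmOutput := measurable_pi_lambda _ measurable_palmOutput
  refine Measure.eq_infinitePi _ fun s B hB => ?_
  rw [Measure.map_apply hmo (.pi s.countable_toSet fun i _ => hB i)]
  obtain ⟨K, hK⟩ : ∃ K : ℕ, ∀ i ∈ s, 0 ≤ i + K := by
    refine ⟨s.sup Int.natAbs, fun i hi => ?_⟩
    have := Finset.le_sup (f := Int.natAbs) hi
    omega
  let σ : Measure ℝ := expMeasure (mu - lam)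
  -- the stationary queue, and the queue with an independent sojourn time of customer `0`,
  -- both observed from the customer `K + n` on
  let E : ℕ → Set (ℝ × (ℤ → ℝ × ℝ)) := fun n =>
    {p | ∀ i ∈ s, palmOutput p.2 (i + (K + n : ℕ)) ∈ B i}
  let F : ℕ → Set (ℝ × (ℤ → ℝ × ℝ)) := fun n =>
    {p | ∀ i ∈ s, iterOutput p.1 p.2 (i + (K + n : ℕ)).toNat ∈ B i}
  refine measure_eq_of_eventually_mem_iff (P := σ.prod (gapServiceSeq lam mu)) (E := E) (F := F)
    ?_ ?_ ?_ ?_ ?_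
  · intro n
    have : E n = ⋂ i ∈ s, (fun p => palmOutput p.2 (i + (K + n : ℕ))) ⁻¹' B i := by ext; simp [E]
    rw [this]
    exact Finset.measurableSet_biInter _ fun i _ =>
      ((measurable_palmOutput _).comp measurable_snd) (hB i)
  · intro n
    have : F n = ⋂ i ∈ s, (fun p => iterOutput p.1 p.2 (i + (K + n : ℕ)).toNat) ⁻¹' B i := by
      ext; simp [F]
    rw [this]
    exact Finset.measurableSet_biInter _ fun i _ => measurable_iterOutput _ (hB i)
  · filter_upwards [Measure.quasiMeasurePreserving_snd.ae (ae_stableInput hlam hmu),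
      Measure.quasiMeasurePreserving_snd.ae (ae_tendsto_netInput_atBot hlam hmu),
      Measure.quasiMeasurePreserving_snd.ae (ae_pos_gapServiceSeq hlam (hlam.trans hmu))]
      with p hst hdr hpos
    obtain ⟨N, hN⟩ := eventually_atTop.1 (eventually_eq_of_nextSojourn (T := iterSojourn p.1 p.2)
      (U := fun n : ℕ => palmDeparture p.2 n - palmArrival p.2 n) (e := fun n : ℕ => p.2 n)
      (fun n => rfl) (fun n => by exact_mod_cast palmSojourn_add_one hst n) (fun n => (hpos n).2)
      hdr)
    filter_upwards [eventually_ge_atTop N] with n hn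
    refine forall₂_congr fun i hi => ?_
    have hi := hK i hi
    have hcast : (((i + (K + n : ℕ)).toNat : ℕ) : ℤ) = i + (K + n : ℕ) :=
      Int.toNat_of_nonneg (by push_cast; omega)
    rw [iterOutput, hN _ (by omega), hcast, palmOutput]
  · intro n
    have hshift := measurePreserving_shift_infinitePi (gapService lam mu) ((K + n : ℕ) : ℤ)
    have hms : MeasurableSet (palmOutput ⁻¹' (Set.pi s B)) :=
      hmo (.pi s.countable_toSet fun i _ => hB i)
    have e1 : E n = Set.univ ×ˢ {ω | ∀ i ∈ s, palmOutput ω (i + (K + n : ℕ)) ∈ B i} := by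
      ext p; simp [E]
    rw [e1, Measure.prod_prod, measure_univ, one_mul]
    refine Eq.trans ?_ (hshift.measure_preimage hms.nullMeasurableSet)
    refine measure_congr ?_
    filter_upwards [ae_stableInput hlam hmu] with ω hω
    refine propext (forall₂_congr fun i _ => ?_)
    have : palmOutput (fun m => ω (m + (K + n : ℕ))) i = palmOutput ω (i + (K + n : ℕ)) := by
      rw [palmOutput, palmOutput, palmDeparture_shift hω, palmArrival_shift,
        sub_sub_sub_cancel_right]
    rw [this]
  · intro n
    have hinj : Set.InjOn (fun i : ℤ => (i + (K + n : ℕ)).toNat) s := by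
      intro i hi j hj hij
      have := hK i hi
      have := hK j hj
      simp only at hij
      omega
    have hback : ∀ i ∈ s, (((i + (K + n : ℕ)).toNat : ℕ) : ℤ) - (K + n : ℕ) = i := by
      intro i hi
      have := hK i hi
      omega
    have h := measure_iterOutput_mem hlam hmu (s.image fun i : ℤ => (i + (K + n : ℕ)).toNat)
      (B := fun j => B ((j : ℤ) - (K + n : ℕ))) (fun j => hB _)
    rw [Finset.prod_image hinj] at h
    rw [Finset.prod_congr rfl fun i hi => by rw [hback i hi]] at h
    rw [← h]
    congr 1
    ext p
    simp only [F, Set.mem_ofPred_eq, Finset.mem_image, forall_exists_index, and_imp,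
      forall_apply_eq_imp_iff₂]
    exact forall₂_congr fun i hi => by rw [hback i hi]

/-- The sojourn time of the typical customer is exponential of parameter `mu - lam`. -/
theorem map_palmSojourn (hlam : 0 < lam) (hmu : lam < mu) :
    Measure.map (fun ω => palmDeparture ω 0) (gapServiceSeq lam mu) = expMeasure (mu - lam) := by
  have hprob := isProbabilityMeasure_gapService hlam (hlam.trans hmu)
  have := isProbabilityMeasure_gapServiceSeq hlam (hlam.trans hmu)
  have := isProbabilityMeasure_expMeasure (sub_pos.2 hmu)
  ext B hB
  rw [Measure.map_apply (measurable_palmDeparture 0) hB]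
  refine measure_eq_of_eventually_mem_iff
    (P := (expMeasure (mu - lam)).prod (gapServiceSeq lam mu))
    (E := fun n => {p | palmDeparture p.2 n - palmArrival p.2 n ∈ B})
    (F := fun n => {p | iterSojourn p.1 p.2 n ∈ B}) ?_ (fun n => measurable_iterSojourn n hB) ?_ ?_
    (fun n => measure_iterSojourn_mem hlam hmu n hB)
  · exact fun n => (((measurable_palmDeparture _).sub (measurable_palmArrival _)).comp
      measurable_snd) hB
  · filter_upwards [Measure.quasiMeasurePreserving_snd.ae (ae_stableInput hlam hmu),
      Measure.quasiMeasurePreserving_snd.ae (ae_tendsto_netInput_atBot hlam hmu),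
      Measure.quasiMeasurePreserving_snd.ae (ae_pos_gapServiceSeq hlam (hlam.trans hmu))]
      with p hst hdr hpos
    filter_upwards [eventually_eq_of_nextSojourn (T := iterSojourn p.1 p.2)
      (U := fun n : ℕ => palmDeparture p.2 n - palmArrival p.2 n) (e := fun n : ℕ => p.2 n)
      (fun n => rfl) (fun n => by exact_mod_cast palmSojourn_add_one hst n) (fun n => (hpos n).2)
      hdr] with n hn
    simp only [hn]
  · intro n
    have hshift := measurePreserving_shift_infinitePi (gapService lam mu) (n : ℤ)
    have e1 : {p : ℝ × (ℤ → ℝ × ℝ) | palmDeparture p.2 n - palmArrival p.2 n ∈ B}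
        = Set.univ ×ˢ {ω | palmDeparture ω n - palmArrival ω n ∈ B} := by
      ext p; simp
    rw [e1, Measure.prod_prod, measure_univ, one_mul]
    refine Eq.trans ?_ (hshift.measure_preimage (measurable_palmDeparture 0 hB).nullMeasurableSet)
    refine measure_congr ?_
    filter_upwards [ae_stableInput hlam hmu] with ω hω
    change (palmDeparture ω n - palmArrival ω n ∈ B)
      = (palmDeparture (fun i => ω (i + n)) 0 ∈ B)
    rw [palmDeparture_shift hω, zero_add]

end PalmBurke

/-! ### Points with exponential gaps around the origin -/

section ExponentialGaps

/-- The law of a two-sided sequence of independent exponential gaps. -/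
noncomputable def gapSeq (lam : ℝ) : Measure (ℤ → ℝ) := Measure.infinitePi fun _ => expMeasure lam

theorem isProbabilityMeasure_gapSeq {lam : ℝ} (hlam : 0 < lam) :
    IsProbabilityMeasure (gapSeq lam) := by
  have := isProbabilityMeasure_expMeasure hlam
  unfold gapSeq; infer_instance

variable {lam : ℝ}

theorem measurable_pointsOfGaps (n : ℤ) : Measurable fun a : ℤ → ℝ => pointsOfGaps a n :=
  Measurable.pointsOfGaps (fun i => by fun_prop) n

theorem pointsOfGaps_update (a : ℤ → ℝ) {n p : ℕ} (hp : p ≤ n) (y : ℝ) :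
    pointsOfGaps (Function.update a n y) p = pointsOfGaps a p :=
  pointsOfGaps_congr (by omega) fun i _ hi => Function.update_of_ne (by omega) _ _

/-- The exponential density has no memory: a gap which leads from a point `w` into an interval to
the right of `w` has density proportional to `exp (-lam z)` there. -/
theorem lintegral_indicator_add_expMeasure (hlam : 0 < lam) {w b c : ℝ} (hw : w ≤ b)
    {g : ℝ → ℝ≥0∞} (hg : Measurable g) :
    ∫⁻ y, (Set.Ioc b c).indicator g (w + y) ∂(expMeasure lam)
      = ENNReal.ofReal lam * (∫⁻ z in Set.Ioc b c, g z * ENNReal.ofReal (Real.exp (-(lam * z))))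
        * ENNReal.ofReal (Real.exp (lam * w)) := by
  have hgi : Measurable ((Set.Ioc b c).indicator g) := hg.indicator measurableSet_Ioc
  have hgw : Measurable fun y => (Set.Ioc b c).indicator g (w + y) :=
    hgi.comp (measurable_const_add w)
  rw [lintegral_expMeasure lam hgw]
  have hm : Measurable fun z => g z * ENNReal.ofReal (Real.exp (-(lam * z))) := by fun_prop
  rw [← lintegral_indicator measurableSet_Ioc,
    ← lintegral_const_mul _ (hm.indicator measurableSet_Ioc),
    ← lintegral_mul_const _ ((hm.indicator measurableSet_Ioc).const_mul _)]
  refine Eq.trans (lintegral_congr fun y => ?_) (lintegral_add_left_eq_self _ w)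
  by_cases hy : w + y ∈ Set.Ioc b c
  · have hy0 : 0 ≤ y := by linarith [hy.1]
    rw [Set.indicator_of_mem hy, Set.indicator_of_mem hy, exponentialPDF_of_nonneg hy0,
      mul_comm (g _), ← mul_assoc, mul_assoc _ (g _), mul_comm (g _), ← mul_assoc,
      ← ENNReal.ofReal_mul hlam.le, ← ENNReal.ofReal_mul (by positivity), mul_assoc lam,
      ← Real.exp_add]
    congr 4
    ring
  · rw [Set.indicator_of_notMem hy, Set.indicator_of_notMem hy]; simp

/-- The last interval of a chain factors out, and leaves the weight `exp (lam * x)` on the last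
but one point `x`. The origin of the chain is distributed by Lebesgue measure. -/
theorem lintegral_chain_succ (hlam : 0 < lam) {b c : ℕ → ℝ} {n : ℕ} (h : c n ≤ b (n + 1))
    {g : ℝ → ℝ≥0∞} (hg : Measurable g) :
    ∫⁻ x, ∫⁻ a, (∏ p ∈ Finset.range (n + 2),
        (Set.Ioc (b p) (c p)).indicator 1 (x + pointsOfGaps a p))
          * g (x + pointsOfGaps a (n + 1 : ℕ))
        ∂(gapSeq lam)
      = ENNReal.ofReal lam
        * (∫⁻ z in Set.Ioc (b (n + 1)) (c (n + 1)), g z * ENNReal.ofReal (Real.exp (-(lam * z))))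
        * ∫⁻ x, ∫⁻ a, (∏ p ∈ Finset.range (n + 1),
            (Set.Ioc (b p) (c p)).indicator 1 (x + pointsOfGaps a p))
              * ENNReal.ofReal (Real.exp (lam * (x + pointsOfGaps a n))) ∂(gapSeq lam) := by
  have := isProbabilityMeasure_expMeasure hlam
  have := isProbabilityMeasure_gapSeq hlam
  have hprod : ∀ k, Measurable fun q : ℝ × (ℤ → ℝ) => ∏ p ∈ Finset.range k,
      (Set.Ioc (b p) (c p)).indicator (1 : ℝ → ℝ≥0∞) (q.1 + pointsOfGaps q.2 p) := fun k =>
    Finset.measurable_fun_prod _ fun p _ => (measurable_one.indicator measurableSet_Ioc).comp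
      (measurable_fst.add ((measurable_pointsOfGaps _).comp measurable_snd))
  have hexp : Measurable fun q : ℝ × (ℤ → ℝ) => (∏ p ∈ Finset.range (n + 1),
      (Set.Ioc (b p) (c p)).indicator (1 : ℝ → ℝ≥0∞) (q.1 + pointsOfGaps q.2 p))
        * ENNReal.ofReal (Real.exp (lam * (q.1 + pointsOfGaps q.2 n))) :=
    (hprod _).mul (((measurable_fst.add ((measurable_pointsOfGaps _).comp
      measurable_snd)).const_mul lam).exp.ennreal_ofReal)
  rw [← lintegral_const_mul _ hexp.lintegral_prod_right']
  refine lintegral_congr fun x => ?_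
  have hG : Measurable fun a : ℤ → ℝ => (∏ p ∈ Finset.range (n + 2),
        (Set.Ioc (b p) (c p)).indicator 1 (x + pointsOfGaps a p))
          * g (x + pointsOfGaps a (n + 1 : ℕ)) :=
    ((hprod _).comp measurable_prodMk_left).mul
      (hg.comp (measurable_const.add (measurable_pointsOfGaps _)))
  have hexp' : Measurable fun a : ℤ → ℝ => (∏ p ∈ Finset.range (n + 1),
      (Set.Ioc (b p) (c p)).indicator (1 : ℝ → ℝ≥0∞) (x + pointsOfGaps a p))
        * ENNReal.ofReal (Real.exp (lam * (x + pointsOfGaps a n))) :=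
    hexp.comp measurable_prodMk_left
  -- the last gap is integrated out first
  rw [gapSeq, lintegral_infinitePi_update _ (n : ℤ) hG, ← lintegral_const_mul _ hexp']
  refine lintegral_congr fun a => ?_
  have hlast : ∀ y, pointsOfGaps (Function.update a n y) (n + 1 : ℕ) = pointsOfGaps a n + y := by
    intro y
    rw [Nat.cast_succ, pointsOfGaps_add_one, pointsOfGaps_update a le_rfl, Function.update_self]
  have hfirst : ∀ y, ∏ p ∈ Finset.range (n + 1), (Set.Ioc (b p) (c p)).indicator (1 : ℝ → ℝ≥0∞)
        (x + pointsOfGaps (Function.update a n y) p)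
      = ∏ p ∈ Finset.range (n + 1), (Set.Ioc (b p) (c p)).indicator 1 (x + pointsOfGaps a p) :=
    fun y => Finset.prod_congr rfl fun p hp => by
      rw [pointsOfGaps_update a (Nat.lt_succ_iff.1 (Finset.mem_range.1 hp))]
  have hind : ∀ y, (Set.Ioc (b (n + 1)) (c (n + 1))).indicator (1 : ℝ → ℝ≥0∞) y * g y
      = (Set.Ioc (b (n + 1)) (c (n + 1))).indicator g y := fun y => by
    by_cases hy : y ∈ Set.Ioc (b (n + 1)) (c (n + 1)) <;> simp [hy]
  simp_rw [Finset.prod_range_succ _ (n + 1), hfirst, hlast, mul_assoc, ← add_assoc, hind]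
  by_cases hx : x + pointsOfGaps a n ∈ Set.Ioc (b n) (c n)
  · have hgw : Measurable fun y =>
        (Set.Ioc (b (n + 1)) (c (n + 1))).indicator g (x + pointsOfGaps a n + y) :=
      (hg.indicator measurableSet_Ioc).comp (measurable_const_add _)
    rw [lintegral_const_mul _ hgw,
      lintegral_indicator_add_expMeasure hlam (hx.2.trans h) hg]
    ring
  · simp [Finset.prod_range_succ, hx]

theorem lintegral_exp_mul (hlam : 0 < lam) {b c : ℝ} (h : b ≤ c) :
    ENNReal.ofReal lam * ∫⁻ z in Set.Ioc b c, ENNReal.ofReal (Real.exp (lam * z))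
      = ENNReal.ofReal (Real.exp (lam * c) - Real.exp (lam * b)) := by
  rw [← ofReal_integral_eq_lintegral_ofReal, ← ENNReal.ofReal_mul hlam.le,
    ← intervalIntegral.integral_of_le h, intervalIntegral.integral_comp_mul_left
      (fun x => Real.exp x) hlam.ne', integral_exp]
  · rw [smul_eq_mul, mul_inv_cancel_left₀ hlam.ne']
  · exact (Continuous.integrableOn_Icc (by fun_prop)).mono_set Set.Ioc_subset_Icc_self
  · exact Eventually.of_forall fun _ => (Real.exp_pos _).le

theorem lintegral_exp_neg_mul (hlam : 0 < lam) {b c : ℝ} (h : b ≤ c) :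
    ENNReal.ofReal lam * ∫⁻ z in Set.Ioc b c, ENNReal.ofReal (Real.exp (-(lam * z)))
      = ENNReal.ofReal (Real.exp (-(lam * b)) - Real.exp (-(lam * c))) := by
  have hl : -lam ≠ 0 := by linarith
  have e : ∀ z, -(lam * z) = -lam * z := fun z => by ring
  simp_rw [e]
  rw [← ofReal_integral_eq_lintegral_ofReal, ← ENNReal.ofReal_mul hlam.le,
    ← intervalIntegral.integral_of_le h, intervalIntegral.integral_comp_mul_left
      (fun x => Real.exp x) hl, integral_exp]
  · rw [smul_eq_mul]; congr 1; field_simp; ring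
  · exact (Continuous.integrableOn_Icc (by fun_prop)).mono_set Set.Ioc_subset_Icc_self
  · exact Eventually.of_forall fun _ => (Real.exp_pos _).le

theorem lintegral_chain_exp (hlam : 0 < lam) {b c : ℕ → ℝ} (n : ℕ)
    (h : ∀ p < n, c p ≤ b (p + 1)) :
    ∫⁻ x, ∫⁻ a, (∏ p ∈ Finset.range (n + 1),
            (Set.Ioc (b p) (c p)).indicator 1 (x + pointsOfGaps a p))
              * ENNReal.ofReal (Real.exp (lam * (x + pointsOfGaps a n))) ∂(gapSeq lam)
      = (∏ p ∈ Finset.range n, ENNReal.ofReal (lam * (c (p + 1) - b (p + 1))))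
        * ∫⁻ z in Set.Ioc (b 0) (c 0), ENNReal.ofReal (Real.exp (lam * z)) := by
  have := isProbabilityMeasure_gapSeq hlam
  induction n with
  | zero =>
    simp only [zero_add, Finset.range_one, Finset.prod_singleton, CharP.cast_eq_zero,
      pointsOfGaps_zero, add_zero, lintegral_const, measure_univ, mul_one, Finset.range_zero,
      Finset.prod_empty, one_mul]
    rw [← lintegral_indicator measurableSet_Ioc]
    refine lintegral_congr fun x => ?_
    by_cases hx : x ∈ Set.Ioc (b 0) (c 0) <;> simp [hx]
  | succ n ih =>
    rw [lintegral_chain_succ hlam (h n (Nat.lt_succ_self n))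
        (g := fun z => ENNReal.ofReal (Real.exp (lam * z))) (by fun_prop),
      ih fun p hp => h p (hp.trans (Nat.lt_succ_self n)), Finset.prod_range_succ]
    have e : ∀ z,
        ENNReal.ofReal (Real.exp (lam * z)) * ENNReal.ofReal (Real.exp (-(lam * z))) = 1 := by
      intro z
      rw [← ENNReal.ofReal_mul (Real.exp_pos _).le, ← Real.exp_add]; simp
    simp_rw [e]
    rw [setLIntegral_one, Real.volume_Ioc, ← ENNReal.ofReal_mul hlam.le]
    ring

/-- The measure, up to the factor `lam`, that the chain of points with exponential gaps assigns to
prescribed successive intervals. -/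
theorem lintegral_chain (hlam : 0 < lam) {b c : ℕ → ℝ} (n : ℕ)
    (h : ∀ p < n + 1, c p ≤ b (p + 1)) (h0 : b 0 ≤ c 0) (hn : b (n + 1) ≤ c (n + 1)) :
    ENNReal.ofReal lam * ∫⁻ x, ∫⁻ a, (∏ p ∈ Finset.range (n + 2),
        (Set.Ioc (b p) (c p)).indicator 1 (x + pointsOfGaps a p)) ∂(gapSeq lam)
      = ENNReal.ofReal (Real.exp (-(lam * b (n + 1))) - Real.exp (-(lam * c (n + 1))))
        * (∏ p ∈ Finset.range n, ENNReal.ofReal (lam * (c (p + 1) - b (p + 1))))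
        * ENNReal.ofReal (Real.exp (lam * c 0) - Real.exp (lam * b 0)) := by
  have h1 := lintegral_chain_succ hlam (h n (Nat.lt_succ_self n)) (g := fun _ => 1) measurable_const
  simp only [mul_one, one_mul] at h1
  rw [h1, lintegral_chain_exp hlam n fun p hp => h p (hp.trans (Nat.lt_succ_self n)),
    lintegral_exp_neg_mul hlam hn, ← lintegral_exp_mul hlam h0]
  ring

/-- The law of the points on the line with exponential gaps which are seen from a uniformly
distributed instant in the gap between the points `0` and `1`, where configurations are weighted
by the length of this gap. -/
noncomputable def sizeBiasedPoints (lam : ℝ) : Measure (ℤ → ℝ) :=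
  ENNReal.ofReal lam • (((gapSeq lam).prod volume).restrict {p | p.2 ∈ Set.Ico 0 (p.1 0)}).map
    fun p n => pointsOfGaps p.1 n - p.2

theorem measurableSet_gap_zero :
    MeasurableSet {p : (ℤ → ℝ) × ℝ | p.2 ∈ Set.Ico 0 (p.1 0)} := by
  have h0 : Measurable fun p : (ℤ → ℝ) × ℝ => p.1 0 := by fun_prop
  exact (measurableSet_le measurable_const measurable_snd).inter
    (measurableSet_lt measurable_snd h0)

theorem measurable_pointsOfGaps_sub :
    Measurable fun (p : (ℤ → ℝ) × ℝ) n => pointsOfGaps p.1 n - p.2 :=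
  measurable_pi_lambda _ fun n =>
    ((measurable_pointsOfGaps n).comp measurable_fst).sub measurable_snd

theorem lintegral_sizeBiasedPoints (hlam : 0 < lam) {F : (ℤ → ℝ) → ℝ≥0∞} (hF : Measurable F) :
    ∫⁻ x, F x ∂(sizeBiasedPoints lam)
      = ENNReal.ofReal lam
        * ∫⁻ a, (∫⁻ u in Set.Ico 0 (a 0), F (fun n => pointsOfGaps a n - u)) ∂(gapSeq lam) := by
  have := isProbabilityMeasure_gapSeq hlam
  have hm : Measurable fun p : (ℤ → ℝ) × ℝ => F fun n => pointsOfGaps p.1 n - p.2 :=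
    hF.comp measurable_pointsOfGaps_sub
  rw [sizeBiasedPoints, lintegral_smul_measure, lintegral_map hF measurable_pointsOfGaps_sub,
    smul_eq_mul, ← lintegral_indicator measurableSet_gap_zero,
    lintegral_prod _ (hm.indicator measurableSet_gap_zero).aemeasurable]
  congr 1
  refine lintegral_congr fun a => ?_
  rw [← lintegral_indicator measurableSet_Ico]
  rfl

theorem isProbabilityMeasure_sizeBiasedPoints (hlam : 0 < lam) :
    IsProbabilityMeasure (sizeBiasedPoints lam) := by
  have := isProbabilityMeasure_expMeasure hlam
  refine ⟨?_⟩
  rw [← lintegral_one, lintegral_sizeBiasedPoints hlam measurable_const]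
  simp only [setLIntegral_one, Real.volume_Ico, sub_zero]
  rw [gapSeq, (measurePreserving_eval_infinitePi (fun _ : ℤ => expMeasure lam)
    0).lintegral_comp ENNReal.measurable_ofReal, lintegral_ofReal_expMeasure hlam,
    ← ENNReal.ofReal_mul hlam.le, mul_inv_cancel₀ hlam.ne', ENNReal.ofReal_one]

/-- Renumbering the points: any other gap may be taken as the one which contains the observer. -/
theorem lintegral_sizeBiasedPoints_renumber (hlam : 0 < lam) {F : (ℤ → ℝ) → ℝ≥0∞}
    (hF : Measurable F) (k : ℤ) :
    ∫⁻ x, F x ∂(sizeBiasedPoints lam)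
      = ENNReal.ofReal lam
        * ∫⁻ a, (∫⁻ u in Set.Ico (pointsOfGaps a k) (pointsOfGaps a (k + 1)),
            F (fun n => pointsOfGaps a (n + k) - u)) ∂(gapSeq lam) := by
  have := isProbabilityMeasure_gapSeq hlam
  have := isProbabilityMeasure_expMeasure hlam
  have hm : Measurable fun a : ℤ → ℝ =>
      ∫⁻ u in Set.Ico 0 (a 0), F (fun n => pointsOfGaps a n - u) := by
    have h1 : Measurable fun a : ℤ → ℝ => ∫⁻ u,
        {p : (ℤ → ℝ) × ℝ | p.2 ∈ Set.Ico 0 (p.1 0)}.indicator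
          (fun p => F (fun n => pointsOfGaps p.1 n - p.2)) (a, u) :=
      ((hF.comp measurable_pointsOfGaps_sub).indicator measurableSet_gap_zero).lintegral_prod_right'
    convert h1 using 2 with a
    rw [← lintegral_indicator measurableSet_Ico]
    rfl
  rw [lintegral_sizeBiasedPoints hlam hF, gapSeq,
    ← (measurePreserving_shift_infinitePi (expMeasure lam) k).lintegral_comp hm]
  congr 1
  refine lintegral_congr fun a => ?_
  rw [← lintegral_indicator measurableSet_Ico, ← lintegral_indicator measurableSet_Ico]
  refine Eq.trans (lintegral_congr fun u => ?_) (lintegral_add_right_eq_self _ (pointsOfGaps a k))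
  have hk := pointsOfGaps_add_one a k
  have hiff : u ∈ Set.Ico 0 (a (0 + k)) ↔
      u + pointsOfGaps a k ∈ Set.Ico (pointsOfGaps a k) (pointsOfGaps a (k + 1)) := by
    rw [hk, zero_add, Set.mem_Ico, Set.mem_Ico]
    constructor <;> rintro ⟨h1, h2⟩ <;> constructor <;> linarith
  by_cases hu : u ∈ Set.Ico 0 (a (0 + k))
  · rw [Set.indicator_of_mem hu, Set.indicator_of_mem (hiff.1 hu)]
    congr 1
    ext n
    rw [pointsOfGaps_shift]; ring
  · rw [Set.indicator_of_notMem hu, Set.indicator_of_notMem (fun h => hu (hiff.2 h))]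

/-- The configurations whose points `-m, …, m + 1` lie in the prescribed intervals. -/
def pointBox (m : ℕ) (b c : ℤ → ℝ) : Set (ℤ → ℝ) :=
  {x | ∀ i ∈ Finset.Icc (-(m : ℤ)) (m + 1), x i ∈ Set.Ioc (b i) (c i)}

/-- The intervals of `pointBox` are arranged from the left to the right, and the origin separates
those with the numbers `0` and `1`. -/
structure BoxOrdered (m : ℕ) (b c : ℤ → ℝ) : Prop where
  le : ∀ i, -(m : ℤ) ≤ i → i ≤ m + 1 → b i ≤ c i
  le_next : ∀ i, -(m : ℤ) ≤ i → i ≤ m → c i ≤ b (i + 1)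
  le_zero : c 0 ≤ 0
  zero_le : 0 ≤ b 1

theorem measurableSet_pointBox (m : ℕ) (b c : ℤ → ℝ) : MeasurableSet (pointBox m b c) := by
  have : pointBox m b c
      = ⋂ i ∈ Finset.Icc (-(m : ℤ)) (m + 1), (fun x => x i) ⁻¹' Set.Ioc (b i) (c i) := by
    ext; simp [pointBox]
  rw [this]
  exact Finset.measurableSet_biInter _ fun i _ => measurable_pi_apply i measurableSet_Ioc

theorem sizeBiasedPoints_pointBox (hlam : 0 < lam) {m : ℕ} {b c : ℤ → ℝ} (h : BoxOrdered m b c) :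
    sizeBiasedPoints lam (pointBox m b c)
      = ENNReal.ofReal (Real.exp (-(lam * b (m + 1))) - Real.exp (-(lam * c (m + 1))))
        * (∏ p ∈ Finset.range (2 * m), ENNReal.ofReal (lam * (c (p + 1 - m) - b (p + 1 - m))))
        * ENNReal.ofReal (Real.exp (lam * c (-m)) - Real.exp (lam * b (-m))) := by
  have := isProbabilityMeasure_gapSeq hlam
  have hmb := measurableSet_pointBox m b c
  rw [← lintegral_indicator_one hmb,
    lintegral_sizeBiasedPoints_renumber hlam (measurable_one.indicator hmb) m]
  have hchain := lintegral_chain hlam (b := fun p => b (p - m)) (c := fun p => c (p - m)) (2 * m)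
    (fun p hp => by
      have := h.le_next (p - m) (by omega) (by omega)
      rwa [show ((p : ℤ) - m + 1) = ((p + 1 : ℕ) : ℤ) - m by push_cast; ring] at this)
    (h.le _ (by simp) (by omega)) (h.le _ (by push_cast; omega) (by push_cast; omega))
  have e1 : ((2 * m + 1 : ℕ) : ℤ) - m = m + 1 := by push_cast; ring
  have e2 : ((0 : ℕ) : ℤ) - m = -m := by simp
  have e3 : ∀ p : ℕ, ((p + 1 : ℕ) : ℤ) - m = p + 1 - m := fun p => by push_cast; ring
  simp only [e1, e2, e3] at hchain
  rw [← hchain]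
  congr 1
  have hprod : Measurable fun q : ℝ × (ℤ → ℝ) => ∏ p ∈ Finset.range (2 * m + 2),
      (Set.Ioc (b (p - m)) (c (p - m))).indicator (1 : ℝ → ℝ≥0∞) (q.1 + pointsOfGaps q.2 p) :=
    Finset.measurable_fun_prod _ fun p _ => (measurable_one.indicator measurableSet_Ioc).comp
      (measurable_fst.add ((measurable_pointsOfGaps _).comp measurable_snd))
  rw [lintegral_lintegral_swap hprod.aemeasurable]
  refine lintegral_congr fun a => ?_
  rw [← lintegral_indicator measurableSet_Ico, ← lintegral_neg_eq_self]
  refine lintegral_congr fun x => ?_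
  by_cases hx : ∀ p ∈ Finset.range (2 * m + 2),
      x + pointsOfGaps a p ∈ Set.Ioc (b (p - m)) (c (p - m))
  · have hm0 := hx m (Finset.mem_range.2 (by omega))
    have hm1 := hx (m + 1) (Finset.mem_range.2 (by omega))
    rw [sub_self] at hm0
    rw [show ((m + 1 : ℕ) : ℤ) - m = 1 by push_cast; ring] at hm1
    have h0 := h.le_zero
    have h1 := h.zero_le
    have hu : -x ∈ Set.Ico (pointsOfGaps a m) (pointsOfGaps a (m + 1)) := by
      rw [Nat.cast_succ] at hm1
      exact ⟨by linarith [hm0.2], by linarith [hm1.1]⟩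
    rw [Set.indicator_of_mem hu, Set.indicator_of_mem, Finset.prod_eq_one]
    · rfl
    · intro p hp
      rw [Set.indicator_of_mem (hx p hp)]; rfl
    · intro i hi
      rw [Finset.mem_Icc] at hi
      have := hx (i + m).toNat (Finset.mem_range.2 (by omega))
      rw [Int.toNat_of_nonneg (by omega), add_sub_cancel_right] at this
      change pointsOfGaps a (i + m) - -x ∈ _
      rwa [sub_neg_eq_add, add_comm]
  · rw [Set.indicator_apply_eq_zero.2]
    · push Not at hx
      obtain ⟨p, hp, hpx⟩ := hx
      exact (Finset.prod_eq_zero hp (Set.indicator_of_notMem hpx _)).symm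
    · intro _
      refine Set.indicator_of_notMem (fun hbox => hx fun p hp => ?_) _
      rw [Finset.mem_range] at hp
      have := hbox (p - m) (Finset.mem_Icc.2 ⟨by omega, by omega⟩)
      change pointsOfGaps a (p - m + m) - -x ∈ _ at this
      rw [sub_add_cancel, sub_neg_eq_add, add_comm] at this
      exact this

end ExponentialGaps

/-! ### The numbered points of a Poisson process -/

section PoissonPoints

theorem finite_setOf_mem_of_isBounded {x : ℤ → ℝ} (htop : Tendsto x atTop atTop)
    (hbot : Tendsto x atBot atBot) {B : Set ℝ} (hB : Bornology.IsBounded B) :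
    {n : ℤ | x n ∈ B}.Finite := by
  obtain ⟨M, hM⟩ := hB.subset_closedBall 0
  obtain ⟨N₁, h₁⟩ := eventually_atTop.1 (htop.eventually_gt_atTop M)
  obtain ⟨N₂, h₂⟩ := eventually_atBot.1 (hbot.eventually_lt_atBot (-M))
  refine (Set.finite_Icc N₂ N₁).subset fun n hn => ?_
  have h := hM hn
  rw [Metric.mem_closedBall, Real.dist_0_eq_abs, abs_le] at h
  constructor
  · by_contra hlt
    linarith [h₂ n (by omega), h.1]
  · by_contra hlt
    linarith [h₁ n (by omega), h.2]

/-- The numbers of the points in the intervals of a box and between them decide whether the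
configuration belongs to the box, if the points are numbered from the origin. -/
theorem mem_pointBox_iff {x : ℤ → ℝ} (hx : StrictMono x) (hx0 : x 0 ≤ 0) (hx1 : 0 < x 1) {m : ℕ}
    {b c : ℤ → ℝ} (h : BoxOrdered m b c) :
    x ∈ pointBox m b c ↔
      (∀ i, -(m : ℤ) ≤ i → i ≤ m + 1 → ∃ n, x n ∈ Set.Ioc (b i) (c i)) ∧
      (∀ i, -(m : ℤ) ≤ i → i ≤ m → ∀ n, x n ∉ Set.Ioc (c i) (b (i + 1))) ∧
      (∀ i, -(m : ℤ) < i → i ≤ m → ∀ n n', x n ∈ Set.Ioc (b i) (c i) →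
        x n' ∈ Set.Ioc (b i) (c i) → n = n') := by
  constructor
  · intro hbox
    have hbox' : ∀ i, -(m : ℤ) ≤ i → i ≤ m + 1 → x i ∈ Set.Ioc (b i) (c i) :=
      fun i h1 h2 => hbox i (Finset.mem_Icc.2 ⟨h1, h2⟩)
    refine ⟨fun i h1 h2 => ⟨i, hbox' i h1 h2⟩, fun i h1 h2 n hn => ?_, ?_⟩
    · have hlt : i < n := hx.lt_iff_lt.1 ((hbox' i h1 (by omega)).2.trans_lt hn.1)
      have hlt' : n < i + 1 :=
        hx.lt_iff_lt.1 (hn.2.trans_lt (hbox' (i + 1) (by omega) (by omega)).1)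
      omega
    · have key : ∀ i, -(m : ℤ) < i → i ≤ m → ∀ n, x n ∈ Set.Ioc (b i) (c i) → n = i := by
        intro i h1 h2 n hn
        have hl := h.le_next (i - 1) (by omega) (by omega)
        rw [sub_add_cancel] at hl
        have hlt : i - 1 < n := hx.lt_iff_lt.1
          (((hbox' (i - 1) (by omega) (by omega)).2.trans hl).trans_lt hn.1)
        have hlt' : n < i + 1 := hx.lt_iff_lt.1
          ((hn.2.trans (h.le_next i (by omega) (by omega))).trans_lt
            (hbox' (i + 1) (by omega) (by omega)).1)
        omega
      exact fun i h1 h2 n n' hn hn' => (key i h1 h2 n hn).trans (key i h1 h2 n' hn').symm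
  · rintro ⟨occ, gap, uniq⟩
    have z0 : x 0 ∈ Set.Ioc (b 0) (c 0) := by
      obtain ⟨n, hn⟩ := occ 0 (by omega) (by omega)
      have hn0 : n < 1 := hx.lt_iff_lt.1 ((hn.2.trans h.le_zero).trans_lt hx1)
      refine ⟨hn.1.trans_le (hx.monotone (by omega)), not_lt.1 fun hlt => ?_⟩
      exact gap 0 (by omega) (by omega) 0 ⟨hlt, by simpa using hx0.trans h.zero_le⟩
    have z1 : x 1 ∈ Set.Ioc (b 1) (c 1) := by
      obtain ⟨n, hn⟩ := occ 1 (by omega) (by omega)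
      have hn0 : 0 < n := hx.lt_iff_lt.1 ((hx0.trans h.zero_le).trans_lt hn.1)
      refine ⟨not_le.1 fun hle => ?_, (hx.monotone (by omega)).trans hn.2⟩
      exact gap 0 (by omega) (by omega) 1 ⟨h.le_zero.trans_lt hx1, by simpa using hle⟩
    have right : ∀ k : ℕ, k ≤ m → x (k + 1) ∈ Set.Ioc (b (k + 1)) (c (k + 1)) := by
      intro k
      induction k with
      | zero => intro _; simpa using z1
      | succ k ih =>
        intro hk
        have ih := ih (by omega)
        push_cast
        set i : ℤ := (k : ℤ) + 1 with hi
        obtain ⟨n, hn⟩ := occ (i + 1) (by omega) (by omega)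
        have hl := h.le_next i (by omega) (by omega)
        have hlt : i < n := hx.lt_iff_lt.1 ((ih.2.trans hl).trans_lt hn.1)
        refine ⟨not_le.1 fun hle => ?_, (hx.monotone (by omega)).trans hn.2⟩
        have hsucc := hx (lt_add_one i)
        rcases le_or_gt (x (i + 1)) (c i) with hc | hc
        · have := uniq i (by omega) (by omega) (i + 1) i ⟨ih.1.trans hsucc, hc⟩ ih
          omega
        · exact gap i (by omega) (by omega) (i + 1) ⟨hc, hle⟩
    have left : ∀ k : ℕ, k ≤ m → x (-k) ∈ Set.Ioc (b (-k)) (c (-k)) := by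
      intro k
      induction k with
      | zero => intro _; simpa using z0
      | succ k ih =>
        intro hk
        have ih := ih (by omega)
        set i : ℤ := -((k + 1 : ℕ) : ℤ) with hi
        rw [show -(k : ℤ) = i + 1 by push_cast at hi; omega] at ih
        obtain ⟨n, hn⟩ := occ i (by omega) (by omega)
        have hl := h.le_next i (by omega) (by omega)
        have hlt : n < i + 1 := hx.lt_iff_lt.1 ((hn.2.trans hl).trans_lt ih.1)
        have hsucc := hx (lt_add_one i)
        refine ⟨hn.1.trans_le (hx.monotone (by omega)), not_lt.1 fun hc => ?_⟩
        rcases le_or_gt (x i) (b (i + 1)) with hle | hle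
        · exact gap i (by omega) (by omega) i ⟨hc, hle⟩
        · have := uniq (i + 1) (by omega) (by omega) i (i + 1) ⟨hle, hsucc.le.trans ih.2⟩ ih
          omega
    intro i hi
    rw [Finset.mem_Icc] at hi
    rcases le_or_gt i 0 with hi0 | hi0
    · have := left (-i).toNat (by omega)
      rwa [show -(((-i).toNat : ℕ) : ℤ) = i by omega] at this
    · have := right (i - 1).toNat (by omega)
      rwa [show (((i - 1).toNat : ℕ) : ℤ) + 1 = i by omega] at this

/-- The disjoint intervals which make up a box, and those between them. -/
def boxCell (m : ℕ) (b c : ℤ → ℝ) : Fin (2 * m + 2) ⊕ Fin (2 * m + 1) → Set ℝ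
  | .inl p => Set.Ioc (b (p - m)) (c (p - m))
  | .inr p => Set.Ioc (c (p - m)) (b (p - m + 1))

/-- The numbers of points in the intervals of `boxCell` for the configurations of a box. The
first and the last interval may contain further points. -/
def boxCount (m : ℕ) : Fin (2 * m + 2) ⊕ Fin (2 * m + 1) → Set ℕ
  | .inl p => if (p : ℕ) = 0 ∨ (p : ℕ) = 2 * m + 1 then {0}ᶜ else {1}
  | .inr _ => {0}

theorem BoxOrdered.le_of_lt {m : ℕ} {b c : ℤ → ℝ} (h : BoxOrdered m b c) {i j : ℤ}
    (hi : -(m : ℤ) ≤ i) (hij : i < j) (hj : j ≤ m + 1) : c i ≤ b j := by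
  obtain ⟨k, rfl⟩ : ∃ k : ℕ, j = i + 1 + k := ⟨(j - i - 1).toNat, by omega⟩
  induction k with
  | zero => simpa using h.le_next i hi (by push_cast at hj; omega)
  | succ k ih =>
    have h1 := ih (by omega) (by push_cast at hj; omega)
    have h2 := h.le (i + 1 + k) (by omega) (by push_cast at hj; omega)
    have h3 := h.le_next (i + 1 + k) (by omega) (by push_cast at hj; omega)
    rw [show i + 1 + ((k + 1 : ℕ) : ℤ) = i + 1 + k + 1 by push_cast; ring]
    linarith

theorem pairwise_disjoint_boxCell {m : ℕ} {b c : ℤ → ℝ} (h : BoxOrdered m b c) :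
    Pairwise fun k l => Disjoint (boxCell m b c k) (boxCell m b c l) := by
  have hle : ∀ p : Fin (2 * m + 2), b (p - m) ≤ c (p - m) :=
    fun p => h.le _ (by omega) (by have := p.2; omega)
  have hlt : ∀ p q : ℕ, p < q → q < 2 * m + 2 → c (p - m) ≤ b (q - m) :=
    fun p q h1 h2 => h.le_of_lt (by omega) (by omega) (by omega)
  have hle' : ∀ p : ℕ, p < 2 * m + 2 → b (p - m) ≤ c (p - m) := fun p hp => hle ⟨p, hp⟩
  -- each cell ends before the next one begins
  have key : ∀ {s t u v : ℝ}, t ≤ u → Disjoint (Set.Ioc s t) (Set.Ioc u v) := fun h =>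
    Set.Ioc_disjoint_Ioc.2 ((min_le_left _ _).trans (h.trans (le_max_right _ _)))
  have e : ∀ p : ℕ, (p : ℤ) - m + 1 = ((p + 1 : ℕ) : ℤ) - m := fun p => by push_cast; ring
  have ll : ∀ p q : Fin (2 * m + 2), p < q →
      Disjoint (boxCell m b c (.inl p)) (boxCell m b c (.inl q)) :=
    fun p q hpq => key (hlt p q hpq q.2)
  have rr : ∀ p q : Fin (2 * m + 1), p < q →
      Disjoint (boxCell m b c (.inr p)) (boxCell m b c (.inr q)) := by
    intro p q hpq
    refine key ?_
    have hpq' : (p : ℕ) < q := hpq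
    have hq := q.2
    rw [e]
    rcases Nat.lt_or_ge (p + 1 : ℕ) q with h1 | h1
    · have h2 := hle' (p + 1) (by omega)
      have h3 := hlt (p + 1) q h1 (by omega)
      have h4 := hle' q (by omega)
      linarith
    · have : (p + 1 : ℕ) = q := by omega
      rw [this]
      exact hle' q (by omega)
  have lr : ∀ (p : Fin (2 * m + 2)) (q : Fin (2 * m + 1)),
      Disjoint (boxCell m b c (.inl p)) (boxCell m b c (.inr q)) := by
    intro p q
    have hq := q.2
    rcases Nat.lt_or_ge (q : ℕ) p with h1 | h1
    · refine (key ?_).symm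
      rw [e]
      rcases Nat.lt_or_ge (q + 1 : ℕ) p with h2 | h2
      · linarith [hle' (q + 1) (by omega), hlt (q + 1) p h2 p.2]
      · have : (q + 1 : ℕ) = p := by omega
        rw [this]
    · refine key ?_
      rcases Nat.lt_or_ge (p : ℕ) q with h2 | h2
      · linarith [hlt p q h2 (by omega), hle' q (by omega)]
      · have : (p : ℕ) = q := by omega
        rw [this]
  rintro (p | p) (q | q) hpq
  · rcases lt_or_gt_of_ne (show p ≠ q by rintro rfl; exact hpq rfl) with h1 | h1
    · exact ll p q h1
    · exact (ll q p h1).symm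
  · exact lr p q
  · exact (lr q p).symm
  · rcases lt_or_gt_of_ne (show p ≠ q by rintro rfl; exact hpq rfl) with h1 | h1
    · exact rr p q h1
    · exact (rr q p h1).symm

/-- `mem_pointBox_iff` in terms of the point counts whose joint law is known for a Poisson
process. -/
theorem mem_pointBox_iff_ncard {x : ℤ → ℝ} (hx : StrictMono x) (htop : Tendsto x atTop atTop)
    (hbot : Tendsto x atBot atBot) (hx0 : x 0 ≤ 0) (hx1 : 0 < x 1) {m : ℕ}
    {b c : ℤ → ℝ} (h : BoxOrdered m b c) :
    x ∈ pointBox m b c ↔ ∀ k, {n : ℤ | x n ∈ boxCell m b c k}.ncard ∈ boxCount m k := by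
  have hfin : ∀ s t : ℝ, {n : ℤ | x n ∈ Set.Ioc s t}.Finite := fun s t =>
    finite_setOf_mem_of_isBounded htop hbot (Metric.isBounded_Ioc s t)
  have zero : ∀ s t : ℝ, {n : ℤ | x n ∈ Set.Ioc s t}.ncard = 0 ↔ ∀ n, x n ∉ Set.Ioc s t := by
    intro s t
    rw [Set.ncard_eq_zero (hfin s t), Set.eq_empty_iff_forall_notMem]
    rfl
  have one : ∀ s t : ℝ, {n : ℤ | x n ∈ Set.Ioc s t}.ncard = 1 ↔ (∃ n, x n ∈ Set.Ioc s t) ∧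
      ∀ n n', x n ∈ Set.Ioc s t → x n' ∈ Set.Ioc s t → n = n' := by
    intro s t
    rw [Set.ncard_eq_one]
    constructor
    · rintro ⟨a, ha⟩
      have ha' : ∀ n, x n ∈ Set.Ioc s t ↔ n = a := fun n => by
        have := Set.ext_iff.1 ha n
        simpa using this
      exact ⟨⟨a, (ha' a).2 rfl⟩, fun n n' hn hn' => ((ha' n).1 hn).trans ((ha' n').1 hn').symm⟩
    · rintro ⟨⟨a, ha⟩, hu⟩
      refine ⟨a, Set.ext fun n => ?_⟩
      exact ⟨fun hn => hu n a hn ha, fun hn => by rw [Set.mem_singleton_iff.1 hn]; exact ha⟩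
  rw [mem_pointBox_iff hx hx0 hx1 h]
  constructor
  · rintro ⟨occ, gap, uniq⟩ (p | p)
    · have hp := p.2
      simp only [boxCell, boxCount]
      split_ifs with h1
      · rw [Set.mem_compl_iff, Set.mem_singleton_iff, zero]
        obtain ⟨n, hn⟩ := occ (p - m) (by omega) (by omega)
        exact fun h2 => h2 n hn
      · rw [Set.mem_singleton_iff, one]
        exact ⟨occ _ (by omega) (by omega), uniq _ (by omega) (by omega)⟩
    · have hp := p.2
      exact (zero _ _).2 (gap _ (by omega) (by omega))
  · intro hk
    refine ⟨fun i h1 h2 => ?_, fun i h1 h2 => ?_, fun i h1 h2 => ?_⟩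
    · have h3 := hk (.inl ⟨(i + m).toNat, by omega⟩)
      have h4 : (((i + m).toNat : ℕ) : ℤ) - m = i := by omega
      simp only [boxCell, boxCount, h4] at h3
      split_ifs at h3
      · rw [Set.mem_compl_iff, Set.mem_singleton_iff, zero] at h3
        push Not at h3
        exact h3
      · rw [Set.mem_singleton_iff, one] at h3
        exact h3.1
    · have h3 := hk (.inr ⟨(i + m).toNat, by omega⟩)
      have h4 : (((i + m).toNat : ℕ) : ℤ) - m = i := by omega
      simp only [boxCell, boxCount, h4, Set.mem_singleton_iff, zero] at h3
      exact h3
    · have h3 := hk (.inl ⟨(i + m).toNat, by omega⟩)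
      have h4 : (((i + m).toNat : ℕ) : ℤ) - m = i := by omega
      simp only [boxCell, boxCount, h4] at h3
      rw [if_neg (by omega), Set.mem_singleton_iff, one] at h3
      exact h3.2

theorem poissonMeasure_zero (r : NNReal) :
    poissonMeasure r {0} = ENNReal.ofReal (Real.exp (-r)) := by
  rw [poissonMeasure_singleton]; simp

theorem poissonMeasure_one (r : NNReal) :
    poissonMeasure r {1} = ENNReal.ofReal (Real.exp (-r) * r) := by
  rw [poissonMeasure_singleton]; simp

theorem poissonMeasure_compl_zero (r : NNReal) :
    poissonMeasure r {0}ᶜ = ENNReal.ofReal (1 - Real.exp (-r)) := by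
  rw [prob_compl_eq_one_sub (MeasurableSet.singleton 0), poissonMeasure_zero,
    ENNReal.ofReal_sub _ (Real.exp_pos _).le, ENNReal.ofReal_one]

variable {Ω : Type*} [MeasurableSpace Ω] {P : Measure Ω} {lam : ℝ} {A : ℤ → Ω → ℝ}

theorem IsPoissonProcess.measure_pointCount_Ioc (hA : IsPoissonProcess P lam A)
    {s t : ℝ} (hst : s ≤ t) (S : Set ℕ) :
    P (pointCount A (Set.Ioc s t) ⁻¹' S) = poissonMeasure (Real.toNNReal (lam * (t - s))) S := by
  have h := hA.hasLaw_count (Set.Ioc s t) measurableSet_Ioc (Metric.isBounded_Ioc s t)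
  rw [Real.volume_real_Ioc_of_le hst] at h
  rw [← h.map_eq, Measure.map_apply_of_aemeasurable h.aemeasurable (.of_discrete)]

/-- Telescoping of the exponents over the intervals of a box and those between them. -/
theorem prod_exp_mul_prod_exp (lam : ℝ) (b c : ℕ → ℝ) (n : ℕ) :
    (∏ p ∈ Finset.range n, Real.exp (-(lam * (c (p + 1) - b (p + 1)))))
      * ∏ p ∈ Finset.range (n + 1), Real.exp (-(lam * (b (p + 1) - c p)))
      = Real.exp (-(lam * (b (n + 1) - c 0))) := by
  induction n with
  | zero => simp
  | succ n ih =>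
    rw [Finset.prod_range_succ, Finset.prod_range_succ _ (n + 1), mul_mul_mul_comm, ih,
      ← Real.exp_add, ← Real.exp_add]
    congr 1; ring

theorem IsPoissonProcess.iIndepFun_pointCount (hA : IsPoissonProcess P lam A) {ι : Type*}
    [Fintype ι] (B : ι → Set ℝ) (hB : ∀ i, MeasurableSet (B i))
    (hb : ∀ i, Bornology.IsBounded (B i)) (hd : Pairwise fun i j => Disjoint (B i) (B j)) :
    iIndepFun (fun i => pointCount A (B i)) P := by
  let e := Fintype.equivFin ι
  have h := hA.indep_count _ (fun k => B (e.symm k)) (fun _ => hB _) (fun _ => hb _)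
    (fun k l hkl => hd (e.symm.injective.ne hkl))
  have h2 := h.precomp e.injective
  simpa using h2

theorem IsPoissonProcess.measure_pointBox (hA : IsPoissonProcess P lam A) (hlam : 0 < lam)
    (hnum : ∀ᵐ ω ∂P, A 0 ω ≤ 0 ∧ 0 < A 1 ω) {m : ℕ} {b c : ℤ → ℝ} (h : BoxOrdered m b c) :
    P {ω | (fun n => A n ω) ∈ pointBox m b c}
      = ENNReal.ofReal (Real.exp (-(lam * b (m + 1))) - Real.exp (-(lam * c (m + 1))))
        * (∏ p ∈ Finset.range (2 * m), ENNReal.ofReal (lam * (c (p + 1 - m) - b (p + 1 - m))))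
        * ENNReal.ofReal (Real.exp (lam * c (-m)) - Real.exp (lam * b (-m))) := by
  have hcell : ∀ k, MeasurableSet (boxCell m b c k) ∧ Bornology.IsBounded (boxCell m b c k) := by
    rintro (p | p) <;> exact ⟨measurableSet_Ioc, Metric.isBounded_Ioc _ _⟩
  have hind := hA.iIndepFun_pointCount (boxCell m b c) (fun k => (hcell k).1) (fun k => (hcell k).2)
    (pairwise_disjoint_boxCell h)
  have hae : {ω | (fun n => A n ω) ∈ pointBox m b c} =ᵐ[P]
      ⋂ k ∈ (Finset.univ : Finset (Fin (2 * m + 2) ⊕ Fin (2 * m + 1))),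
        pointCount A (boxCell m b c k) ⁻¹' boxCount m k := by
    filter_upwards [hA.strictMono, hA.tendsto_atTop, hA.tendsto_atBot, hnum] with ω h1 h2 h3 h4
    have h5 : ω ∈ (⋂ k ∈ (Finset.univ : Finset (Fin (2 * m + 2) ⊕ Fin (2 * m + 1))),
        pointCount A (boxCell m b c k) ⁻¹' boxCount m k)
        ↔ ∀ k, pointCount A (boxCell m b c k) ω ∈ boxCount m k := by
      simp only [Finset.mem_univ, Set.iInter_true, Set.mem_iInter, Set.mem_preimage]
    exact propext ((mem_pointBox_iff_ncard h1 h2 h3 h4.1 h4.2 h).trans h5.symm)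
  rw [measure_congr hae, hind.measure_inter_preimage_eq_mul _ fun _ _ => .of_discrete,
    Fintype.prod_sum_type]
  have hle : ∀ p : ℕ, p < 2 * m + 2 → b (p - m) ≤ c (p - m) :=
    fun p hp => h.le _ (by omega) (by omega)
  have hnext : ∀ p : ℕ, p < 2 * m + 1 → c (p - m) ≤ b ((p + 1 : ℕ) - m) := fun p hp => by
    have := h.le_next (p - m) (by omega) (by omega)
    rwa [show ((p : ℤ) - m + 1) = ((p + 1 : ℕ) : ℤ) - m by push_cast; ring] at this
  let b' : ℕ → ℝ := fun p => b (p - m)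
  let c' : ℕ → ℝ := fun p => c (p - m)
  have hnn : ∀ {s t : ℝ}, s ≤ t → ((Real.toNNReal (lam * (t - s)) : NNReal) : ℝ) = lam * (t - s) :=
    fun hst => Real.coe_toNNReal _ (mul_nonneg hlam.le (sub_nonneg.2 hst))
  let u : ℕ → ℝ≥0∞ := fun p => if p = 0 ∨ p = 2 * m + 1
    then ENNReal.ofReal (1 - Real.exp (-(lam * (c' p - b' p))))
    else ENNReal.ofReal (Real.exp (-(lam * (c' p - b' p))) * (lam * (c' p - b' p)))
  have hu : ∀ p : Fin (2 * m + 2),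
      P (pointCount A (boxCell m b c (.inl p)) ⁻¹' boxCount m (.inl p)) = u p := by
    intro p
    rw [boxCell, hA.measure_pointCount_Ioc (hle p p.2), boxCount]
    simp only [u, b', c']
    split_ifs
    · rw [poissonMeasure_compl_zero, hnn (hle p p.2)]
    · rw [poissonMeasure_one, hnn (hle p p.2)]
  have hv : ∀ p : Fin (2 * m + 1),
      P (pointCount A (boxCell m b c (.inr p)) ⁻¹' boxCount m (.inr p))
        = (fun p : ℕ => ENNReal.ofReal (Real.exp (-(lam * (b' (p + 1) - c' p))))) p := by
    intro p
    have h1 := hnext p p.2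
    rw [boxCell, show ((p : ℕ) : ℤ) - m + 1 = ((p + 1 : ℕ) : ℤ) - m by push_cast; ring,
      hA.measure_pointCount_Ioc h1, boxCount, poissonMeasure_zero, hnn h1]
  rw [Finset.prod_congr rfl fun p _ => hu p, Finset.prod_congr rfl fun p _ => hv p,
    Fin.prod_univ_eq_prod_range u,
    Fin.prod_univ_eq_prod_range (fun p : ℕ =>
      ENNReal.ofReal (Real.exp (-(lam * (b' (p + 1) - c' p))))),
    Finset.prod_range_succ, Finset.prod_range_succ']
  have hmid : ∀ p ∈ Finset.range (2 * m), u (p + 1)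
      = ENNReal.ofReal (lam * (c' (p + 1) - b' (p + 1)))
        * ENNReal.ofReal (Real.exp (-(lam * (c' (p + 1) - b' (p + 1))))) := by
    intro p hp
    rw [Finset.mem_range] at hp
    simp only [u]
    rw [if_neg (by omega), ENNReal.ofReal_mul (Real.exp_pos _).le, mul_comm]
  have hfirst : u 0 = ENNReal.ofReal (1 - Real.exp (-(lam * (c' 0 - b' 0)))) := by simp [u]
  have hlast : u (2 * m + 1)
      = ENNReal.ofReal (1 - Real.exp (-(lam * (c' (2 * m + 1) - b' (2 * m + 1))))) := by simp [u]
  rw [Finset.prod_congr rfl hmid, Finset.prod_mul_distrib, hfirst, hlast]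
  have htel := congrArg ENNReal.ofReal (prod_exp_mul_prod_exp lam b' c' (2 * m))
  rw [ENNReal.ofReal_mul (Finset.prod_nonneg fun _ _ => (Real.exp_pos _).le),
    ENNReal.ofReal_prod_of_nonneg fun _ _ => (Real.exp_pos _).le,
    ENNReal.ofReal_prod_of_nonneg fun _ _ => (Real.exp_pos _).le] at htel
  have e1 : b' (2 * m + 1) = b (m + 1) := by simp only [b']; congr 1; push_cast; ring
  have e2 : c' (2 * m + 1) = c (m + 1) := by simp only [c']; congr 1; push_cast; ring
  have e3 : b' 0 = b (-m) := by simp only [b']; congr 1; push_cast; ring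
  have e4 : c' 0 = c (-m) := by simp only [c']; congr 1; push_cast; ring
  have e5 : ∀ p : ℕ, b' (p + 1) = b (p + 1 - m) := fun p => by simp only [b']; push_cast; rfl
  have e6 : ∀ p : ℕ, c' (p + 1) = c (p + 1 - m) := fun p => by simp only [c']; push_cast; rfl
  have h0 : b' 0 ≤ c' 0 := hle 0 (by omega)
  have hN : b' (2 * m + 1) ≤ c' (2 * m + 1) := hle _ (by omega)
  have hends : ENNReal.ofReal (1 - Real.exp (-(lam * (c' 0 - b' 0))))
        * ENNReal.ofReal (1 - Real.exp (-(lam * (c' (2 * m + 1) - b' (2 * m + 1)))))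
        * ENNReal.ofReal (Real.exp (-(lam * (b' (2 * m + 1) - c' 0))))
      = ENNReal.ofReal (Real.exp (-(lam * b' (2 * m + 1))) - Real.exp (-(lam * c' (2 * m + 1))))
        * ENNReal.ofReal (Real.exp (lam * c' 0) - Real.exp (lam * b' 0)) := by
    have p1 : 0 ≤ 1 - Real.exp (-(lam * (c' 0 - b' 0))) :=
      sub_nonneg.2 (Real.exp_le_one_iff.2 (by nlinarith))
    have p2 : 0 ≤ 1 - Real.exp (-(lam * (c' (2 * m + 1) - b' (2 * m + 1)))) :=
      sub_nonneg.2 (Real.exp_le_one_iff.2 (by nlinarith))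
    have p3 : 0 ≤ Real.exp (-(lam * b' (2 * m + 1))) - Real.exp (-(lam * c' (2 * m + 1))) :=
      sub_nonneg.2 (Real.exp_le_exp.2 (by nlinarith))
    rw [← ENNReal.ofReal_mul p1, ← ENNReal.ofReal_mul (mul_nonneg p1 p2), ← ENNReal.ofReal_mul p3]
    congr 1
    simp only [mul_sub, sub_mul, one_mul, mul_one, ← Real.exp_add]
    ring_nf
  rw [← e1, ← e2, ← e3, ← e4]
  simp_rw [← e5, ← e6]
  refine Eq.trans ?_ (mul_right_comm _ _ _)
  rw [← hends, ← htel]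
  ring

end PoissonPoints

section Uniqueness

/-- The increasing configurations, numbered from the origin, without a point at the origin. -/
def numberedPoints : Set (ℤ → ℝ) := {x | (∀ n, x n < x (n + 1)) ∧ x 0 < 0 ∧ 0 < x 1}

theorem measurableSet_numberedPoints : MeasurableSet numberedPoints := by
  have h1 : MeasurableSet {x : ℤ → ℝ | ∀ n, x n < x (n + 1)} := by
    have : {x : ℤ → ℝ | ∀ n, x n < x (n + 1)} = ⋂ n, {x | x n < x (n + 1)} := by ext; simp
    rw [this]
    exact .iInter fun n => measurableSet_lt (measurable_pi_apply _) (measurable_pi_apply _)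
  exact h1.inter ((measurableSet_lt (measurable_pi_apply _) measurable_const).inter
    (measurableSet_lt measurable_const (measurable_pi_apply _)))

/-- Boxes with different numbers of intervals are intersected in the larger number; a nonempty
intersection is again ordered. -/
theorem isPiSystem_pointBox :
    IsPiSystem {s : Set (ℤ → ℝ) | ∃ m b c, BoxOrdered m b c ∧ s = pointBox m b c} := by
  have key : ∀ {m m' : ℕ} {b c b' c' : ℤ → ℝ}, m ≤ m' → BoxOrdered m b c → BoxOrdered m' b' c' →
      (pointBox m b c ∩ pointBox m' b' c').Nonempty →
      ∃ m'' b'' c'', BoxOrdered m'' b'' c'' ∧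
        pointBox m b c ∩ pointBox m' b' c' = pointBox m'' b'' c'' := by
    rintro m m' b c b' c' hm h h' ⟨y, hy, hy'⟩
    let J := Finset.Icc (-(m : ℤ)) (m + 1)
    let b'' : ℤ → ℝ := fun i => if i ∈ J then max (b i) (b' i) else b' i
    let c'' : ℤ → ℝ := fun i => if i ∈ J then min (c i) (c' i) else c' i
    have hb : ∀ i, b' i ≤ b'' i := fun i => by
      simp only [b'']; split_ifs
      exacts [le_max_right _ _, le_rfl]
    have hc : ∀ i, c'' i ≤ c' i := fun i => by
      simp only [c'']; split_ifs
      exacts [min_le_right _ _, le_rfl]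
    have hIoc : ∀ i, Set.Ioc (b'' i) (c'' i)
        = if i ∈ J then Set.Ioc (b i) (c i) ∩ Set.Ioc (b' i) (c' i) else Set.Ioc (b' i) (c' i) := by
      intro i
      simp only [b'', c'']
      split_ifs
      · rw [Set.Ioc_inter_Ioc]
      · rfl
    have heq : pointBox m b c ∩ pointBox m' b' c' = pointBox m' b'' c'' := by
      ext x
      constructor
      · rintro ⟨h1, h2⟩ i hi
        rw [hIoc]
        split_ifs with hJ
        · exact ⟨h1 i hJ, h2 i hi⟩
        · exact h2 i hi
      · intro h1
        refine ⟨fun i hi => ?_, fun i hi => ?_⟩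
        · have hi' : i ∈ Finset.Icc (-(m' : ℤ)) (m' + 1) := by
            rw [Finset.mem_Icc] at hi ⊢; omega
          have h2 := h1 i hi'
          rw [hIoc, if_pos hi] at h2
          exact h2.1
        · have h2 := h1 i hi
          rw [hIoc] at h2
          split_ifs at h2
          exacts [h2.2, h2]
    refine ⟨m', b'', c'', ⟨fun i h1 h2 => ?_, fun i h1 h2 => ?_, ?_, ?_⟩, heq⟩
    · have hy'' : y ∈ pointBox m' b'' c'' := heq ▸ ⟨hy, hy'⟩
      have := hy'' i (Finset.mem_Icc.2 ⟨h1, h2⟩)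
      exact this.1.le.trans this.2
    · exact (hc i).trans ((h'.le_next i h1 h2).trans (hb _))
    · exact (hc 0).trans h'.le_zero
    · exact h'.zero_le.trans (hb 1)
  rintro _ ⟨m, b, c, h, rfl⟩ _ ⟨m', b', c', h', rfl⟩ hne
  rcases le_total m m' with hm | hm
  · exact key hm h h' hne
  · rw [Set.inter_comm] at hne ⊢
    exact key hm h' h hne

/-- Every neighbourhood of a numbered configuration contains an ordered box around it. -/
theorem exists_pointBox_subset {x : ℤ → ℝ} (hx : x ∈ numberedPoints) {O : Set (ℤ → ℝ)}
    (hO : O ∈ 𝓝 x) :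
    ∃ m b c, BoxOrdered m b c ∧ pointBox m b c ∈ 𝓝 x ∧ pointBox m b c ⊆ O := by
  rw [nhds_pi, Filter.mem_pi] at hO
  obtain ⟨I, hI, t, ht, hsub⟩ := hO
  obtain ⟨m, hm⟩ : ∃ m : ℕ, ∀ i ∈ I, i ∈ Finset.Icc (-(m : ℤ)) (m + 1) := by
    refine ⟨hI.toFinset.sup Int.natAbs, fun i hi => ?_⟩
    have := Finset.le_sup (f := Int.natAbs) (hI.mem_toFinset.2 hi)
    rw [Finset.mem_Icc]; omega
  choose ε hε hball using fun i => Metric.mem_nhds_iff.1 (ht i)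
  -- the box has half-width `δ`, less than half of all relevant gaps
  obtain ⟨δ, hδ, hδi⟩ : ∃ δ > 0, ∀ i ∈ Finset.Icc (-(m : ℤ)) (m + 1),
      δ < ε i ∧ 2 * δ < x (i + 1) - x i ∧ δ < -x 0 ∧ δ < x 1 := by
    have hpos : ∀ i, 0 < min (min (ε i) ((x (i + 1) - x i) / 2)) (min (-x 0) (x 1)) := fun i =>
      lt_min (lt_min (hε i) (by linarith [hx.1 i])) (lt_min (by linarith [hx.2.1]) hx.2.2)
    obtain ⟨j, -, hj⟩ := Finset.exists_min_image (Finset.Icc (-(m : ℤ)) (m + 1))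
      (fun i => min (min (ε i) ((x (i + 1) - x i) / 2)) (min (-x 0) (x 1))) ⟨0, by simp; omega⟩
    refine ⟨_, half_pos (hpos j), fun i hi => ?_⟩
    have h1 := (half_lt_self (hpos j)).trans_le (hj i hi)
    rw [lt_min_iff, lt_min_iff, lt_min_iff] at h1
    exact ⟨h1.1.1, by linarith [h1.1.2], h1.2.1, h1.2.2⟩
  have h0 := hδi 0 (by simp; omega)
  refine ⟨m, fun i => x i - δ, fun i => x i + δ, ⟨fun i _ _ => by linarith, fun i h1 h2 => ?_,
    by linarith [h0.2.2.1], by linarith [h0.2.2.2]⟩, ?_, ?_⟩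
  · linarith [(hδi i (Finset.mem_Icc.2 ⟨h1, by omega⟩)).2.1]
  · have : pointBox m (fun i => x i - δ) (fun i => x i + δ)
        = (Finset.Icc (-(m : ℤ)) (m + 1) : Set ℤ).pi fun i => Set.Ioc (x i - δ) (x i + δ) := by
      ext y; simp [pointBox, Set.mem_pi]
    rw [this]
    exact set_pi_mem_nhds (Finset.finite_toSet _) fun i _ =>
      Ioc_mem_nhds (by linarith) (by linarith)
  · intro y hy
    refine hsub fun i hi => hball i ?_
    have h1 := hy i (hm i hi)
    rw [Metric.mem_ball, Real.dist_eq, abs_lt]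
    have h2 := (hδi i (hm i hi)).1
    constructor <;> linarith [h1.1, h1.2]

/-- The law of a numbered configuration is determined by the ordered boxes. -/
theorem ext_of_pointBox {μ ν : Measure (ℤ → ℝ)} [IsProbabilityMeasure μ] [IsProbabilityMeasure ν]
    (hμ : ∀ᵐ x ∂μ, x ∈ numberedPoints) (hν : ∀ᵐ x ∂ν, x ∈ numberedPoints)
    (h : ∀ m b c, BoxOrdered m b c → μ (pointBox m b c) = ν (pointBox m b c)) : μ = ν := by
  let C : Set (Set (ℤ → ℝ)) := {s | ∃ m b c, BoxOrdered m b c ∧ s = pointBox m b c}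
  have hgen : ∀ s, MeasurableSet[MeasurableSpace.generateFrom C] s → μ s = ν s := by
    intro s hs
    refine ext_on_measurableSpace_of_generate_finite (m := MeasurableSpace.generateFrom C)
      _ C ?_ ?_ rfl isPiSystem_pointBox (by simp) hs
    · rintro _ ⟨m, b, c, hbc, rfl⟩
      exact h m b c hbc
    · refine MeasurableSpace.generateFrom_le ?_
      rintro _ ⟨m, b, c, -, rfl⟩
      exact measurableSet_pointBox m b c
  refine ext_of_generate_finite {O : Set (ℤ → ℝ) | IsOpen O} ?_ isPiSystem_isOpen ?_ (by simp)
  · exact BorelSpace.measurable_eq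
  · intro O (hO : IsOpen O)
    -- up to a null set, an open set is a countable union of ordered boxes
    have hbox : ∀ x ∈ O ∩ numberedPoints,
        ∃ s ∈ C, s ∈ 𝓝[O ∩ numberedPoints] x ∧ s ⊆ O := by
      rintro x ⟨hxO, hx⟩
      obtain ⟨m, b, c, h1, h2, h3⟩ := exists_pointBox_subset hx (hO.mem_nhds hxO)
      exact ⟨_, ⟨m, b, c, h1, rfl⟩, mem_nhdsWithin_of_mem_nhds h2, h3⟩
    choose! f hfC hfn hfO using hbox
    obtain ⟨t, htO, htc, hcov⟩ := TopologicalSpace.countable_cover_nhdsWithin hfn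
    have hU : MeasurableSet[MeasurableSpace.generateFrom C] (⋃ x ∈ t, f x) :=
      MeasurableSet.biUnion htc fun x hx =>
        MeasurableSpace.measurableSet_generateFrom (hfC x (htO hx))
    have hsub : (⋃ x ∈ t, f x) ⊆ O := Set.iUnion₂_subset fun x hx => hfO x (htO hx)
    have hae : ∀ {κ : Measure (ℤ → ℝ)}, (∀ᵐ x ∂κ, x ∈ numberedPoints) →
        κ O = κ (⋃ x ∈ t, f x) := by
      intro κ hκ
      refine measure_congr ?_
      filter_upwards [hκ] with x hx
      exact propext ⟨fun hxO => hcov ⟨hxO, hx⟩, fun hxU => hsub hxU⟩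
    rw [hae hμ, hae hν, hgen _ hU]

variable {lam : ℝ}

theorem ae_numberedPoints_sizeBiasedPoints (hlam : 0 < lam) :
    ∀ᵐ x ∂(sizeBiasedPoints lam), x ∈ numberedPoints := by
  have := isProbabilityMeasure_expMeasure hlam
  have := isProbabilityMeasure_gapSeq hlam
  rw [sizeBiasedPoints]
  refine Measure.ae_smul_measure ?_ _
  rw [ae_map_iff (p := (· ∈ numberedPoints)) measurable_pointsOfGaps_sub.aemeasurable
    measurableSet_numberedPoints, ae_restrict_iff' measurableSet_gap_zero]
  have hpos : ∀ᵐ a ∂(gapSeq lam), ∀ i, 0 < a i := ae_all_iff.2 fun i =>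
    (measurePreserving_eval_infinitePi (fun _ : ℤ => expMeasure lam)
      i).quasiMeasurePreserving.ae (ae_pos_expMeasure lam)
  have hne : ∀ᵐ u : ℝ, u ≠ 0 := by simp [ae_iff]
  filter_upwards [Measure.quasiMeasurePreserving_fst.ae hpos,
    Measure.quasiMeasurePreserving_snd.ae hne] with p h1 h2 h3
  refine ⟨fun n => ?_, ?_, ?_⟩
  · dsimp only
    rw [pointsOfGaps_add_one]; linarith [h1 n]
  · dsimp only
    rw [pointsOfGaps_zero]; linarith [lt_of_le_of_ne h3.1 (Ne.symm h2)]
  · dsimp only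
    have := pointsOfGaps_add_one p.1 0
    rw [zero_add, pointsOfGaps_zero] at this
    rw [this]; linarith [h3.2]

variable {Ω : Type*} [MeasurableSpace Ω] {P : Measure Ω} {A : ℤ → Ω → ℝ}

theorem IsPoissonProcess.ae_ne_zero (hA : IsPoissonProcess P lam A) (n : ℤ) :
    ∀ᵐ ω ∂P, A n ω ≠ 0 := by
  have h := hA.hasLaw_count {0} (MeasurableSet.singleton 0) Bornology.isBounded_singleton
  have h0 : P (pointCount A {0} ⁻¹' {0}ᶜ) = 0 := by
    rw [← Measure.map_apply_of_aemeasurable h.aemeasurable .of_discrete, h.map_eq,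
      poissonMeasure_compl_zero]
    simp [measureReal_def]
  have h1 : ∀ᵐ ω ∂P, pointCount A {0} ω = 0 := by
    rw [ae_iff]; exact h0
  filter_upwards [h1, hA.tendsto_atTop, hA.tendsto_atBot] with ω h1 h2 h3 h4
  rw [pointCount, Set.ncard_eq_zero (finite_setOf_mem_of_isBounded h2 h3
    Bornology.isBounded_singleton)] at h1
  exact Set.eq_empty_iff_forall_notMem.1 h1 n h4

/-- The numbered points of a Poisson process: exponential gaps, seen from a uniformly distributed
instant in a gap chosen with a bias for its length. -/
theorem IsPoissonProcess.map_eq_sizeBiasedPoints [IsProbabilityMeasure P]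
    (hA : IsPoissonProcess P lam A) (hlam : 0 < lam) (hnum : ∀ᵐ ω ∂P, A 0 ω ≤ 0 ∧ 0 < A 1 ω) :
    P.map (fun ω n => A n ω) = sizeBiasedPoints lam := by
  have hm : Measurable fun ω n => A n ω := measurable_pi_lambda _ hA.measurable
  have := isProbabilityMeasure_sizeBiasedPoints hlam
  have := Measure.isProbabilityMeasure_map (μ := P) hm.aemeasurable
  refine ext_of_pointBox ?_ (ae_numberedPoints_sizeBiasedPoints hlam) fun m b c h => ?_
  · rw [ae_map_iff (p := (· ∈ numberedPoints)) hm.aemeasurable measurableSet_numberedPoints]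
    filter_upwards [hA.strictMono, hnum, hA.ae_ne_zero 0] with ω h1 h2 h3
    exact ⟨fun n => h1 (lt_add_one n), lt_of_le_of_ne h2.1 h3, h2.2⟩
  · rw [Measure.map_apply hm (measurableSet_pointBox m b c), sizeBiasedPoints_pointBox hlam h,
      ← hA.measure_pointBox hlam hnum h]
    rfl

end Uniqueness

/-! ### Arrival cycles and departure cycles of the queue -/

section MarkSum

/-- The counting measure of the marked points `(x n, c n)`. -/
noncomputable def markSum (x c : ℤ → ℝ) : Measure (ℝ × ℝ) :=
  Measure.sum fun n : ℤ => Measure.dirac (x n, c n)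

theorem measurable_markSum {α : Type*} [MeasurableSpace α] {x c : α → ℤ → ℝ}
    (hx : ∀ n, Measurable fun a => x a n) (hc : ∀ n, Measurable fun a => c a n) :
    Measurable fun a => markSum (x a) (c a) := by
  refine Measure.measurable_of_measurable_coe _ fun s hs => ?_
  simp only [markSum, Measure.sum_apply _ hs, Measure.dirac_apply' _ hs]
  exact Measurable.tsum fun n =>
    (measurable_one.indicator hs).comp ((hx n).prodMk (hc n))

theorem markSum_shift (x c : ℤ → ℝ) (j : ℤ) :
    markSum (fun n => x (n + j)) (fun n => c (n + j)) = markSum x c := by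
  ext s hs
  simp only [markSum, Measure.sum_apply _ hs]
  exact (Equiv.addRight j).tsum_eq fun n => Measure.dirac (x n, c n) s

end MarkSum

theorem Measurable.setLIntegral_Ico {α : Type*} [MeasurableSpace α] {a b : α → ℝ}
    (ha : Measurable a) (hb : Measurable b) {f : α × ℝ → ℝ≥0∞} (hf : Measurable f) :
    Measurable fun x => ∫⁻ u in Set.Ico (a x) (b x), f (x, u) := by
  have hS : MeasurableSet {p : α × ℝ | p.2 ∈ Set.Ico (a p.1) (b p.1)} :=
    (measurableSet_le (ha.comp measurable_fst) measurable_snd).inter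
      (measurableSet_lt measurable_snd (hb.comp measurable_fst))
  have := (hf.indicator hS).lintegral_prod_right' (ν := (volume : Measure ℝ))
  convert this using 2 with x
  rw [← lintegral_indicator measurableSet_Ico]
  rfl

theorem setLIntegral_Ico_add {a b c : ℝ} (hab : a ≤ b) (hbc : b ≤ c) (f : ℝ → ℝ≥0∞) :
    (∫⁻ u in Set.Ico a b, f u) + ∫⁻ u in Set.Ico b c, f u = ∫⁻ u in Set.Ico a c, f u := by
  rw [← Set.Ico_union_Ico_eq_Ico hab hbc, lintegral_union measurableSet_Ico]
  exact Set.disjoint_left.2 fun u h1 h2 => absurd h1.2 (not_lt.2 h2.1)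

theorem setLIntegral_Ico_add_right (a b t : ℝ) (f : ℝ → ℝ≥0∞) :
    ∫⁻ u in Set.Ico a b, f (u + t) = ∫⁻ u in Set.Ico (a + t) (b + t), f u := by
  rw [← lintegral_indicator measurableSet_Ico, ← lintegral_indicator measurableSet_Ico,
    ← lintegral_add_right_eq_self ((Set.Ico (a + t) (b + t)).indicator f) t]
  congr 1; ext u
  simp only [Set.indicator, Set.mem_Ico, add_le_add_iff_right, add_lt_add_iff_right]

section Cycle

variable {lam mu : ℝ}

/-- A stationary function of time has the same mean integral over a cycle between two successive
arrivals and over a cycle between two successive departures: the two integrals differ by the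
increment, from one customer to the next, of the integral over the sojourn of a customer. The
latter has a finite mean, since the sojourn times have. -/
theorem lintegral_arrival_cycle_eq_departure_cycle (hlam : 0 < lam) (hmu : lam < mu)
    {K : (ℤ → ℝ × ℝ) × ℝ → ℝ≥0∞} (hK : Measurable K) (hK1 : ∀ p, K p ≤ 1)
    (hshift : ∀ᵐ ω ∂(gapServiceSeq lam mu), ∀ u,
      K (fun i => ω (i + 1), u) = K (ω, u + palmArrival ω 1)) :
    ∫⁻ ω, (∫⁻ u in Set.Ico (palmArrival ω 0) (palmArrival ω 1), K (ω, u)) ∂(gapServiceSeq lam mu)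
      = ∫⁻ ω, (∫⁻ u in Set.Ico (palmDeparture ω 0) (palmDeparture ω 1), K (ω, u))
          ∂(gapServiceSeq lam mu) := by
  have := isProbabilityMeasure_gapService hlam (hlam.trans hmu)
  have hst := ae_stableInput hlam hmu
  have hm : ∀ n m, Measurable fun ω =>
      ∫⁻ u in Set.Ico (palmArrival ω n) (palmDeparture ω m), K (ω, u) := fun n m =>
    (measurable_palmArrival n).setLIntegral_Ico (measurable_palmDeparture m) hK
  have hI : Measurable fun ω =>
      ∫⁻ u in Set.Ico (palmArrival ω 0) (palmArrival ω 1), K (ω, u) :=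
    (measurable_palmArrival 0).setLIntegral_Ico (measurable_palmArrival 1) hK
  have hstep : ∫⁻ ω, (∫⁻ u in Set.Ico (palmArrival ω 1) (palmDeparture ω 1), K (ω, u))
        ∂(gapServiceSeq lam mu)
      = ∫⁻ ω, (∫⁻ u in Set.Ico (palmArrival ω 0) (palmDeparture ω 0), K (ω, u))
        ∂(gapServiceSeq lam mu) := by
    have hθ : MeasurePreserving (fun (ω : ℤ → ℝ × ℝ) n => ω (n + 1))
        (gapServiceSeq lam mu) (gapServiceSeq lam mu) :=
      measurePreserving_shift_infinitePi (gapService lam mu) 1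
    rw [← hθ.lintegral_comp (hm 0 0)]
    refine lintegral_congr_ae ?_
    filter_upwards [hst, hshift] with ω h1 h2
    simp only [h2]
    rw [setLIntegral_Ico_add_right _ _ _ fun u => K (ω, u), palmArrival_shift,
      palmDeparture_shift h1]
    simp
  have hfin : ∫⁻ ω, (∫⁻ u in Set.Ico (palmArrival ω 0) (palmDeparture ω 0), K (ω, u))
      ∂(gapServiceSeq lam mu) ≠ ∞ := by
    refine ne_top_of_le_ne_top ?_ (lintegral_mono (g := fun ω => ENNReal.ofReal (palmDeparture ω 0))
      fun ω => ?_)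
    · rw [← lintegral_map (f := fun t => ENNReal.ofReal t) (by fun_prop)
        (measurable_palmDeparture 0), map_palmSojourn hlam hmu,
        lintegral_ofReal_expMeasure (sub_pos.2 hmu)]
      exact ENNReal.ofReal_ne_top
    · calc ∫⁻ u in Set.Ico (palmArrival ω 0) (palmDeparture ω 0), K (ω, u)
          ≤ ∫⁻ _ in Set.Ico (palmArrival ω 0) (palmDeparture ω 0), 1 :=
            lintegral_mono fun u => hK1 _
        _ = ENNReal.ofReal (palmDeparture ω 0) := by simp [palmArrival]
  have hsum : ∫⁻ ω, (∫⁻ u in Set.Ico (palmArrival ω 0) (palmArrival ω 1), K (ω, u))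
          ∂(gapServiceSeq lam mu)
        + ∫⁻ ω, (∫⁻ u in Set.Ico (palmArrival ω 1) (palmDeparture ω 1), K (ω, u))
          ∂(gapServiceSeq lam mu)
      = ∫⁻ ω, (∫⁻ u in Set.Ico (palmDeparture ω 0) (palmDeparture ω 1), K (ω, u))
          ∂(gapServiceSeq lam mu)
        + ∫⁻ ω, (∫⁻ u in Set.Ico (palmArrival ω 0) (palmDeparture ω 0), K (ω, u))
          ∂(gapServiceSeq lam mu) := by
    rw [← lintegral_add_left hI, ← lintegral_add_right _ (hm 0 0)]
    refine lintegral_congr_ae ?_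
    filter_upwards [hst] with ω h
    have h0 : palmArrival ω 0 ≤ palmDeparture ω 0 := (h.arrival_lt_departureTime 0).le
    have h1 : palmArrival ω 1 ≤ palmDeparture ω 1 := (h.arrival_lt_departureTime 1).le
    have h2 : palmDeparture ω 0 ≤ palmDeparture ω 1 := (h.strictMono_departureTime zero_lt_one).le
    rw [setLIntegral_Ico_add (h.strictMono zero_lt_one).le h1, add_comm,
      setLIntegral_Ico_add h0 h2]
  rw [hstep] at hsum
  exact (ENNReal.add_left_inj hfin).1 hsum

/-- A functional of the marked arrivals and the same functional of the marked departures have the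
same mean integral over an arrival cycle: `map_palmOutput` turns the former into an integral over a
departure cycle. -/
theorem lintegral_cycle_markSum (hlam : 0 < lam) (hmu : lam < mu)
    {G : Measure (ℝ × ℝ) → ℝ≥0∞} (hG : Measurable G) (hG1 : ∀ κ, G κ ≤ 1) :
    ∫⁻ ω, (∫⁻ u in Set.Ico 0 (ω 0).1,
        G (markSum (fun n => palmArrival ω n - u) fun n => (ω n).2)) ∂(gapServiceSeq lam mu)
      = ∫⁻ ω, (∫⁻ u in Set.Ico 0 (ω 0).1,
        G (markSum (fun n => palmDeparture ω n - u) fun n => (palmOutput ω n).2))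
          ∂(gapServiceSeq lam mu) := by
  have hst := ae_stableInput hlam hmu
  have hm : Measurable fun ω => ∫⁻ u in Set.Ico 0 (ω 0).1,
      G (markSum (fun n => palmArrival ω n - u) fun n => (ω n).2) := by
    refine Measurable.setLIntegral_Ico measurable_const (by fun_prop) (hG.comp
      (measurable_markSum (α := (ℤ → ℝ × ℝ) × ℝ) (x := fun p n => palmArrival p.1 n - p.2)
        (c := fun p n => (p.1 n).2)
        (fun n => ((measurable_palmArrival n).comp measurable_fst).sub measurable_snd)
        (fun n => by fun_prop)))
  let K : (ℤ → ℝ × ℝ) × ℝ → ℝ≥0∞ := fun p =>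
    G (markSum (fun n => palmDeparture p.1 n - p.2) fun n => (palmOutput p.1 n).2)
  have hK : Measurable K := hG.comp (measurable_markSum
    (fun n => ((measurable_palmDeparture n).comp measurable_fst).sub measurable_snd)
    (fun n => ((measurable_palmOutput n).comp measurable_fst).snd))
  have h1 : ∫⁻ ω, (∫⁻ u in Set.Ico 0 (ω 0).1,
        G (markSum (fun n => palmArrival ω n - u) fun n => (ω n).2)) ∂(gapServiceSeq lam mu)
      = ∫⁻ ω, (∫⁻ u in Set.Ico (palmDeparture ω 0) (palmDeparture ω 1), K (ω, u))
          ∂(gapServiceSeq lam mu) := by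
    rw [← map_palmOutput hlam hmu,
      lintegral_map hm (measurable_pi_lambda _ measurable_palmOutput), map_palmOutput hlam hmu]
    refine lintegral_congr_ae ?_
    filter_upwards [hst] with ω h
    have e1 : ∀ n, palmArrival (palmOutput ω) n = palmDeparture ω n - palmDeparture ω 0 := by
      intro n
      rw [eq_sub_iff_add_eq', eq_comm]
      exact eq_pointsOfGaps_add (fun n => by rw [palmOutput_eq h]; ring) n
    have e2 : (palmOutput ω 0).1 = palmDeparture ω 1 - palmDeparture ω 0 := by
      rw [palmOutput_eq h, zero_add]
    have e3 : Set.Ico (palmDeparture ω 0) (palmDeparture ω 1)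
        = Set.Ico (0 + palmDeparture ω 0) ((palmOutput ω 0).1 + palmDeparture ω 0) := by
      rw [e2, zero_add, sub_add_cancel]
    rw [e3, ← setLIntegral_Ico_add_right]
    simp only [e1, K, sub_sub, add_comm]
  rw [h1, ← lintegral_arrival_cycle_eq_departure_cycle hlam hmu hK (fun p => hG1 _)]
  · refine lintegral_congr fun ω => ?_
    have : palmArrival ω 1 = (ω 0).1 := by
      have := palmArrival_add_one ω 0
      simpa [palmArrival] using this
    rw [this]
    simp [palmArrival, K]
  · filter_upwards [hst] with ω h u
    have e : ∀ n, palmOutput (fun i => ω (i + 1)) n = palmOutput ω (n + 1) := by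
      intro n
      simp only [palmOutput, palmDeparture_shift h, palmArrival_shift, sub_sub_sub_cancel_right]
    simp only [K, e, palmDeparture_shift h]
    rw [← markSum_shift (fun n => palmDeparture ω n - (u + palmArrival ω 1)) _ 1]
    simp only [sub_sub, add_comm]

end Cycle

/-! ### From the arrival cycle to the stationary queue -/

section Stationary

variable {lam mu : ℝ} {Ω : Type*} [MeasurableSpace Ω] {P : Measure Ω} [IsProbabilityMeasure P]
  {A c : ℤ → Ω → ℝ}

/-- Palm inversion for the Poisson process with independent exponential marks. Mark `n` is paired
with the gap after point `n`, whereas `palmService` pairs it with the gap before; as the marks are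
i.i.d. and independent of the points, both pairings are legitimate
(see `IsPoissonProcess.lintegral_palm`). -/
theorem IsPoissonProcess.lintegral_marked_eq (hlam : 0 < lam) (hmu : 0 < mu)
    (hA : IsPoissonProcess P lam A) (hnum : ∀ᵐ ω ∂P, A 0 ω ≤ 0 ∧ 0 < A 1 ω)
    (hc_meas : ∀ n, Measurable (c n)) (hc_law : ∀ n, HasLaw (c n) (expMeasure mu) P)
    (hc_indep : iIndepFun c P) (hAc : IndepFun (fun ω n => A n ω) (fun ω n => c n ω) P)
    {F : (ℤ → ℝ) × (ℤ → ℝ) → ℝ≥0∞} (hF : Measurable F) :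
    ∫⁻ ω, F (fun n => A n ω, fun n => c n ω) ∂P
      = ENNReal.ofReal lam * ∫⁻ ω, (∫⁻ u in Set.Ico 0 (ω 0).1,
          F (fun n => palmArrival ω n - u, fun n => (ω n).2)) ∂(gapServiceSeq lam mu) := by
  have := isProbabilityMeasure_expMeasure hlam
  have := isProbabilityMeasure_expMeasure hmu
  have := isProbabilityMeasure_gapSeq hlam
  have := isProbabilityMeasure_sizeBiasedPoints hlam
  have hAm : Measurable fun ω n => A n ω := measurable_pi_lambda _ hA.measurable
  have hcm : Measurable fun ω n => c n ω := measurable_pi_lambda _ hc_meas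
  have hlaw : P.map (fun ω n => c n ω) = Measure.infinitePi fun _ : ℤ => expMeasure mu := by
    rw [hc_indep.map_fun_eq_infinitePi_map₀ hcm.aemeasurable]
    simp only [fun n => (hc_law n).map_eq]
  have hjoint : P.map (fun ω => ((fun n => A n ω), fun n => c n ω))
      = (sizeBiasedPoints lam).prod (Measure.infinitePi fun _ : ℤ => expMeasure mu) := by
    rw [(indepFun_iff_map_prod_eq_prod_map_map hAm.aemeasurable hcm.aemeasurable).1 hAc, hlaw,
      hA.map_eq_sizeBiasedPoints hlam hnum]
  let G : (ℤ → ℝ) × (ℤ → ℝ) → ℝ≥0∞ := fun p =>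
    ∫⁻ u in Set.Ico 0 (p.1 0), F (fun n => pointsOfGaps p.1 n - u, p.2)
  have hG : Measurable G := by
    refine Measurable.setLIntegral_Ico (α := (ℤ → ℝ) × (ℤ → ℝ)) (a := fun _ => 0)
      (b := fun p => p.1 0) (f := fun q => F (fun n => pointsOfGaps q.1.1 n - q.2, q.1.2))
      measurable_const (by fun_prop) (hF.comp (Measurable.prodMk ?_ (by fun_prop)))
    exact measurable_pi_lambda _ fun n =>
      ((measurable_pointsOfGaps n).comp (by fun_prop)).sub measurable_snd
  have hzip := measurePreserving_zip_infinitePi (ι := ℤ) (expMeasure lam) (expMeasure mu)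
  have hR : Measurable fun ω : ℤ → ℝ × ℝ => G (fun n => (ω n).1, fun n => (ω n).2) :=
    hG.comp (by fun_prop)
  calc ∫⁻ ω, F (fun n => A n ω, fun n => c n ω) ∂P
      = ∫⁻ z, F z ∂(P.map (fun ω => ((fun n => A n ω), fun n => c n ω))) :=
        (lintegral_map hF (hAm.prodMk hcm)).symm
    _ = ∫⁻ y, ∫⁻ x, F (x, y) ∂(sizeBiasedPoints lam)
          ∂(Measure.infinitePi fun _ : ℤ => expMeasure mu) := by
        rw [hjoint, lintegral_prod_symm' _ hF]
    _ = ∫⁻ y, ENNReal.ofReal lam * ∫⁻ a, G (a, y) ∂(gapSeq lam)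
          ∂(Measure.infinitePi fun _ : ℤ => expMeasure mu) :=
        lintegral_congr fun y => lintegral_sizeBiasedPoints hlam (hF.comp (by fun_prop))
    _ = ENNReal.ofReal lam * ∫⁻ p, G p
          ∂((gapSeq lam).prod (Measure.infinitePi fun _ : ℤ => expMeasure mu)) := by
        rw [lintegral_const_mul _ hG.lintegral_prod_left', lintegral_prod_symm' _ hG]
    _ = ENNReal.ofReal lam * ∫⁻ ω, G (fun n => (ω n).1, fun n => (ω n).2)
          ∂(gapServiceSeq lam mu) := by
        rw [gapServiceSeq, gapService, ← hzip.lintegral_comp hR]; rfl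
    _ = _ := rfl

theorem measurableSet_stableInput :
    MeasurableSet {p : (ℤ → ℝ) × (ℤ → ℝ) | StableInput p.1 p.2} := by
  have e : {p : (ℤ → ℝ) × (ℤ → ℝ) | StableInput p.1 p.2}
      = (⋂ n, {p | p.1 n < p.1 (n + 1)}) ∩ {p | Tendsto (fun n => p.1 n) atTop atTop}
        ∩ {p | Tendsto (fun n => p.1 n) atBot atBot} ∩ (⋂ n, {p | 0 < p.2 n})
        ∩ {p | Tendsto (fun k => p.1 k + ∑ i ∈ Finset.Icc k 0, p.2 i) atBot atBot} := by
    ext p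
    simp only [Set.mem_ofPred_eq, Set.mem_inter_iff, Set.mem_iInter]
    exact ⟨fun h => ⟨⟨⟨⟨fun n => h.strictMono (lt_add_one n), h.tendsto_atTop⟩, h.tendsto_atBot⟩,
      h.service_pos⟩, h.drift⟩,
      fun h => ⟨strictMono_int_of_lt_succ h.1.1.1.1, h.1.1.1.2, h.1.1.2, h.1.2, h.2⟩⟩
  have h1 : ∀ n, Measurable fun p : (ℤ → ℝ) × (ℤ → ℝ) => p.1 n := fun n => by fun_prop
  have h2 : ∀ n, Measurable fun p : (ℤ → ℝ) × (ℤ → ℝ) => p.2 n := fun n => by fun_prop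
  rw [e]
  exact ((((MeasurableSet.iInter fun n => measurableSet_lt (h1 n) (h1 (n + 1))).inter
    (measurableSet_tendsto _ h1)).inter (measurableSet_tendsto _ h1)).inter
    (MeasurableSet.iInter fun n => measurableSet_lt measurable_const (h2 n))).inter
    (measurableSet_tendsto _ fun k => (h1 k).add (Finset.measurable_sum _ fun i _ => h2 i))

/-- The output of the queue: the departure instants and the back times. -/
noncomputable def queueOutput (p : (ℤ → ℝ) × (ℤ → ℝ)) : (ℤ → ℝ) × (ℤ → ℝ) :=
  (departureTime p.1 p.2, fun n => min (departureTime p.1 p.2 n) (p.1 (n + 1)) - p.1 n)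

theorem measurable_queueOutput : Measurable queueOutput := by
  have hD : ∀ n, Measurable fun p : (ℤ → ℝ) × (ℤ → ℝ) => departureTime p.1 p.2 n :=
    measurable_departureTime (α := (ℤ → ℝ) × (ℤ → ℝ)) (x := fun k p => p.1 k)
      (s := fun k p => p.2 k) (fun k => by fun_prop) (fun k => by fun_prop)
  refine Measurable.prodMk (measurable_pi_lambda _ hD) (measurable_pi_lambda _ fun n => ?_)
  exact ((hD n).min (by fun_prop)).sub (by fun_prop)

theorem queueOutput_palm {ω : ℤ → ℝ × ℝ} (h : StableInput (palmArrival ω) (palmService ω)) (u : ℝ) :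
    queueOutput (fun n => palmArrival ω n - u, palmService ω)
      = (fun n => palmDeparture ω n - u, fun n => (palmOutput ω n).2) := by
  unfold queueOutput
  ext n
  · exact h.departureTime_sub u n
  · simp only [h.departureTime_sub u n, palmOutput_eq h, min_sub_sub_right,
      sub_sub_sub_cancel_right, palmDeparture]

/-- Palm inversion, in the numbering of `palmService`. -/
theorem IsPoissonProcess.lintegral_palm (hlam : 0 < lam) (hmu : 0 < mu)
    (hA : IsPoissonProcess P lam A) (hnum : ∀ᵐ ω ∂P, A 0 ω ≤ 0 ∧ 0 < A 1 ω)
    (hc_meas : ∀ n, Measurable (c n)) (hc_law : ∀ n, HasLaw (c n) (expMeasure mu) P)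
    (hc_indep : iIndepFun c P) (hAc : IndepFun (fun ω n => A n ω) (fun ω n => c n ω) P)
    {F : (ℤ → ℝ) × (ℤ → ℝ) → ℝ≥0∞} (hF : Measurable F) :
    ∫⁻ ω, F (fun n => A n ω, fun n => c n ω) ∂P
      = ENNReal.ofReal lam * ∫⁻ ω, (∫⁻ u in Set.Ico 0 (ω 0).1,
          F (fun n => palmArrival ω n - u, palmService ω)) ∂(gapServiceSeq lam mu) := by
  -- the marks are renumbered, which changes neither their law nor their independence of `A`
  have h := hA.lintegral_marked_eq hlam hmu hnum (c := fun n => c (n + 1))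
    (fun n => hc_meas (n + 1)) (fun n => hc_law (n + 1))
    (hc_indep.precomp (add_left_injective 1))
    (hAc.comp (φ := id) (ψ := fun (y : ℤ → ℝ) n => y (n + 1)) measurable_id (by fun_prop))
    (F := fun p => F (p.1, fun n => p.2 (n - 1))) (hF.comp (by fun_prop))
  simp only [sub_add_cancel] at h
  exact h

theorem IsPoissonProcess.ae_stableInput (hlam : 0 < lam) (hmu : lam < mu)
    (hA : IsPoissonProcess P lam A) (hnum : ∀ᵐ ω ∂P, A 0 ω ≤ 0 ∧ 0 < A 1 ω)
    (hc_meas : ∀ n, Measurable (c n)) (hc_law : ∀ n, HasLaw (c n) (expMeasure mu) P)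
    (hc_indep : iIndepFun c P) (hAc : IndepFun (fun ω n => A n ω) (fun ω n => c n ω) P) :
    ∀ᵐ ω ∂P, StableInput (fun n => A n ω) (fun n => c n ω) := by
  let S : Set ((ℤ → ℝ) × (ℤ → ℝ)) := {p | StableInput p.1 p.2}
  have hS : MeasurableSet Sᶜ := measurableSet_stableInput.compl
  have hm : Measurable fun ω => ((fun n => A n ω), fun n => c n ω) :=
    (measurable_pi_lambda _ hA.measurable).prodMk (measurable_pi_lambda _ hc_meas)
  have h := hA.lintegral_palm hlam (hlam.trans hmu) hnum hc_meas hc_law hc_indep hAc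
    (F := Sᶜ.indicator 1) (measurable_one.indicator hS)
  have h0 : ∫⁻ ω, (∫⁻ u in Set.Ico 0 (ω 0).1, Sᶜ.indicator (1 : (ℤ → ℝ) × (ℤ → ℝ) → ℝ≥0∞)
      (fun n => palmArrival ω n - u, palmService ω)) ∂(gapServiceSeq lam mu) = 0 := by
    rw [← lintegral_zero (μ := gapServiceSeq lam mu)]
    refine lintegral_congr_ae ?_
    filter_upwards [_root_.ae_stableInput hlam hmu] with ω hω
    have : ∀ u, ((fun n => palmArrival ω n - u), palmService ω) ∉ Sᶜ := fun u hu =>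
      hu (hω.sub_const u)
    simp only [Set.indicator_of_notMem (this _), lintegral_zero]
  rw [h0, mul_zero] at h
  rw [ae_iff]
  exact (lintegral_indicator_one (hm hS)).symm.trans h

end Stationary

theorem theorem1 {Ω : Type*} [MeasurableSpace Ω] (P : Measure Ω) [IsProbabilityMeasure P]
    (lam mu : ℝ) (hlam : 0 < lam) (hstable : lam < mu)
    (A s : ℤ → Ω → ℝ)
    (hA : IsPoissonProcess P lam A)
    (hnum : ∀ᵐ ω ∂P, A 0 ω ≤ 0 ∧ 0 < A 1 ω)
    (hs_meas : ∀ n, Measurable (s n))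
    (hs_law : ∀ n, HasLaw (s n) (expMeasure mu) P)
    (hs_indep : iIndepFun s P)
    (hAs : IndepFun (fun ω n => A n ω) (fun ω n => s n ω) P) :
    (∀ᵐ ω ∂P, ∀ n : ℤ,
      BddAbove (Set.range fun k : Set.Iic n => departureCandidate A s n k ω)) ∧
    IsPointProcess P (departure A s) ∧
    (∀ n, Measurable (backTime A s n)) ∧
    (∀ᵐ ω ∂P, ∀ n : ℤ, 0 < backTime A s n ω) ∧
    IdentDistrib (markedPointMeasure (departure A s) (backTime A s))
      (markedPointMeasure A s) P P := by
  have hst := hA.ae_stableInput hlam hstable hnum hs_meas hs_law hs_indep hAs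
  have hD : ∀ n, Measurable (departure A s n) := fun n =>
    measurable_departureTime hA.measurable hs_meas n
  have hr : ∀ n, Measurable (backTime A s n) := fun n =>
    ((hD n).min (hA.measurable (n + 1))).sub (hA.measurable n)
  have hM : Measurable (markedPointMeasure (departure A s) (backTime A s)) :=
    measurable_markSum (x := fun ω n => departure A s n ω) (c := fun ω n => backTime A s n ω) hD hr
  have hN : Measurable (markedPointMeasure A s) :=
    measurable_markSum (x := fun ω n => A n ω) (c := fun ω n => s n ω) hA.measurable hs_meas
  refine ⟨hst.mono fun ω h => h.bddAbove,
    ⟨hD, hst.mono fun ω h => h.strictMono_departureTime,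
      hst.mono fun ω h => h.tendsto_departureTime_atTop,
      hst.mono fun ω h => h.tendsto_departureTime_atBot⟩,
    hr, hst.mono fun ω h => h.backTime_pos, hM.aemeasurable, hN.aemeasurable, ?_⟩
  ext E hE
  rw [Measure.map_apply hM hE, Measure.map_apply hN hE, ← lintegral_indicator_one (hM hE),
    ← lintegral_indicator_one (hN hE)]
  let G : Measure (ℝ × ℝ) → ℝ≥0∞ := E.indicator 1
  have hG : Measurable G := measurable_one.indicator hE
  have hG1 : ∀ κ, G κ ≤ 1 := Set.indicator_le_self' (by simp)
  have hsum : Measurable fun p : (ℤ → ℝ) × (ℤ → ℝ) => markSum p.1 p.2 :=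
    measurable_markSum (fun n => by fun_prop) (fun n => by fun_prop)
  have h1 := hA.lintegral_palm hlam (hlam.trans hstable) hnum hs_meas hs_law hs_indep hAs
    (F := fun p => G (markSum (queueOutput p).1 (queueOutput p).2))
    (hG.comp (hsum.comp measurable_queueOutput))
  have h2 := hA.lintegral_marked_eq hlam (hlam.trans hstable) hnum hs_meas hs_law hs_indep hAs
    (F := fun p => G (markSum p.1 p.2)) (hG.comp hsum)
  refine h1.trans (Eq.trans ?_ h2.symm)
  rw [lintegral_cycle_markSum hlam hstable hG hG1]
  congr 1
  refine lintegral_congr_ae ?_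
  filter_upwards [ae_stableInput hlam hstable] with ω h
  simp only [queueOutput_palm h]
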